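/- Let $M$ be a smooth (finite-dimensional, Hausdorff, second countable) manifold without boundary and let $\mathbb E$ be a finite-dimensional Banach space. A section $\mathtt f$ of $\mathbb E^*\otimes TM$ is a choice of a linear map $\mathtt f|_p:\mathbb E\to T_pM$ for every $p\in M$. A family of sections is *uniformly locally Lipschitz* if every $p\in M$ has a coordinate neighbourhood in which, in the induced trivialization, all members of the family are Lipschitz with one common constant. $\mathrm{Lip}\Gamma(\mathbb E^*\otimes TM)$ is the set of sections $\mathtt f$ such that $\{\mathtt f\}$ is uniformly locally Lipschitz. A sequence $(\mathtt f_n)$ in it converges to $\mathtt f_\infty$ if it is uniformly locally Lipschitz and every $p\in M$ has a coordinate neighbourhood on which $\mathtt f_n\to\mathtt f_\infty$ uniformly on compact sets. The *sequential topology* on $\mathrm{Lip}\Gamma(\mathbb E^*\otimes TM)$ is the one whose open sets are the sets $U$ such that every sequence converging to a point of $U$ is eventually in $U$. The *weak\* topology* of $L^\infty([0,1];\mathbb E)$ is the one it carries as the dual of $L^1([0,1];\mathbb E^*)$, with pairing $\langle v|u\rangle=\int_0^1\langle v(t)|u(t)\rangle\,dt$. The *sequential weak\* topology* is the one whose open sets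 are the sets $U\subset L^\infty([0,1];\mathbb E)$ such that every sequence that weakly\* converges to a point of $U$ is eventually in $U$. For $(o,\mathtt f,u)\in M\times \mathrm{Lip}\Gamma(\mathbb E^*\otimes TM)\times L^\infty([0,1];\mathbb E)$ consider the Cauchy problem $$\gamma'(t)=\mathtt f|_{\gamma(t)}[u(t)]\ \text{ for a.e. } t\in[0,1],\qquad \gamma(0)=o,$$ for absolutely continuous curves $\gamma:[0,1]\to M$. Let $\mathscr D_{\mathrm{End}}$ be the set of those triples for which it has a solution on all of $[0,1]$, and let the *End-point map* $\mathrm{End}:\mathscr D_{\mathrm{End}}\to M$ be $\mathrm{End}(o,\mathtt f,u)=\mathrm{End}^{\mathtt f}_o(u)=\gamma(1)$. **Theorem.** The Cauchy problem has at most one solution on $[0,1]$, so that $\mathrm{End}$ is well defined. The set $\mathscr D_{\mathrm{End}}$ is open in $M\times \mathrm{Lip}\Gamma(\mathbb E^*\otimes TM)\times L^\infty([0,1];\mathbb E)$ for the product of the manifold topology, the sequential topology and the sequential weak\* topology, and $\mathrm{End}:\mathscr D_{\mathrm{End}}\to M$ is continuous. Moreover, let $\hat o\in M$, $\hat{\mathtt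 f}\in \mathrm{Lip}\Gamma(\mathbb E^*\otimes TM)$ and let $\mathscr U\subset L^\infty([0,1];\mathbb E)$ be a weak\*-compact set such that $(\hat o,\hat{\mathtt f},u)\in\mathscr D_{\mathrm{End}}$ for every $u\in\mathscr U$. Then the limit $$\lim_{(o,\mathtt f)\to(\hat o,\hat{\mathtt f})}\mathrm{End}^{\mathtt f}_o=\mathrm{End}^{\hat{\mathtt f}}_{\hat o}$$ is uniform on $\mathscr U$: for every neighbourhood $V$ of the diagonal in $M\times M$ there is a neighbourhood of $(\hat o,\hat{\mathtt f})$ in $M\times\mathrm{Lip}\Gamma(\mathbb E^*\otimes TM)$ such that, for every $(o,\mathtt f)$ in it and every $u\in\mathscr U$, one has $(o,\mathtt f,u)\in\mathscr D_{\mathrm{End}}$ and $\bigl(\mathrm{End}^{\hat{\mathtt f}}_{\hat o}(u),\mathrm{End}^{\mathtt f}_o(u)\bigr)\in V$. -/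

import Mathlib

open Set Filter Topology MeasureTheory
open scoped Manifold ContDiff

noncomputable section

/-- The sequential topology generated by a notion of convergence `conv x a` ("the sequence `x`
converges to `a`"): a set is open iff every sequence that converges to one of its points is
eventually in it. -/
abbrev seqTopology {X : Type*} (conv : (ℕ → X) → X → Prop) : TopologicalSpace X where
  IsOpen U := ∀ (x : ℕ → X) (a : X), conv x a → a ∈ U → ∀ᶠ n in atTop, x n ∈ U
  isOpen_univ := fun _ _ _ _ => Eventually.of_forall fun _ => mem_univ _
  isOpen_inter := fun _ _ hs ht x a hx ha => (hs x a hx ha.1).and (ht x a hx ha.2)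
  isOpen_sUnion := fun _ hS x a hx ha => by
    obtain ⟨s, hs, has⟩ := ha
    exact (hS s hs x a hx has).mono fun n hn => ⟨s, hs, hn⟩

/-- The representation of a section `f` of the bundle `E* ⊗ TM` (a choice of a linear map
`f p : E → T_p M` for every `p`) in the trivialization induced by a chart `e`: the map
`x ↦ d e ∘ f (e⁻¹ x)`, meaningful for `x ∈ e.target`. -/
def sectionInChart {m : ℕ} {E M : Type*} [NormedAddCommGroup E] [NormedSpace ℝ E]
    [TopologicalSpace M] [ChartedSpace (EuclideanSpace ℝ (Fin m)) M]
    (e : OpenPartialHomeomorph M (EuclideanSpace ℝ (Fin m)))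
    (f : (p : M) → E →L[ℝ] TangentSpace (𝓡 m) p)
    (x : EuclideanSpace ℝ (Fin m)) : E →L[ℝ] EuclideanSpace ℝ (Fin m) :=
  (mfderiv (𝓡 m) (𝓡 m) e (e.symm x)).comp (f (e.symm x))

/-- A family of sections of `E* ⊗ TM` is uniformly locally Lipschitz if every point of `M` has a
coordinate neighbourhood in which all members of the family are Lipschitz with one common
constant. -/
def UniformlyLocallyLipschitz {m : ℕ} {E M : Type*} [NormedAddCommGroup E] [NormedSpace ℝ E]
    [TopologicalSpace M] [ChartedSpace (EuclideanSpace ℝ (Fin m)) M]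
    (F : Set ((p : M) → E →L[ℝ] TangentSpace (𝓡 m) p)) : Prop :=
  ∀ p : M, ∃ e ∈ IsManifold.maximalAtlas (𝓡 m) ∞ M, p ∈ e.source ∧
    ∃ L : NNReal, ∀ f ∈ F, LipschitzOnWith L (sectionInChart e f) e.target

/-- `LipΓ(E* ⊗ TM)`: the locally Lipschitz sections of `E* ⊗ TM`, i.e. the Lipschitz-vector-field
structures on the `m`-dimensional manifold `M` modelled by `E`. -/
def LipSection (m : ℕ) (E M : Type*) [NormedAddCommGroup E] [NormedSpace ℝ E]
    [TopologicalSpace M] [ChartedSpace (EuclideanSpace ℝ (Fin m)) M] : Type _ :=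
  {f : (p : M) → E →L[ℝ] TangentSpace (𝓡 m) p // UniformlyLocallyLipschitz {f}}

/-- Convergence of a sequence of Lipschitz-vector-field structures: the sequence is uniformly
locally Lipschitz, and every point has a coordinate neighbourhood in which the sequence converges
uniformly on compact sets. -/
def LipSection.Converges {m : ℕ} {E M : Type*} [NormedAddCommGroup E] [NormedSpace ℝ E]
    [TopologicalSpace M] [ChartedSpace (EuclideanSpace ℝ (Fin m)) M]
    (f : ℕ → LipSection m E M) (g : LipSection m E M) : Prop :=
  UniformlyLocallyLipschitz (range fun n => (f n).1) ∧
    ∀ p : M, ∃ e ∈ IsManifold.maximalAtlas (𝓡 m) ∞ M, p ∈ e.source ∧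
      ∀ K : Set (EuclideanSpace ℝ (Fin m)), K ⊆ e.target → IsCompact K →
        TendstoUniformlyOn (fun n => sectionInChart e (f n).1) (sectionInChart e g.1) atTop K

/-- The sequential topology on `LipΓ(E* ⊗ TM)`. -/
instance {m : ℕ} {E M : Type*} [NormedAddCommGroup E] [NormedSpace ℝ E]
    [TopologicalSpace M] [ChartedSpace (EuclideanSpace ℝ (Fin m)) M] :
    TopologicalSpace (LipSection m E M) :=
  seqTopology LipSection.Converges

/-- The space of controls `L^∞([0,1]; E)`, as a set; it is a new type so that it does not carry
the norm topology. -/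
def Control (E : Type*) [NormedAddCommGroup E] : Type _ :=
  Lp E ⊤ (volume.restrict (Icc (0 : ℝ) 1))

/-- The value at time `t` of (a representative of) a control. -/
def Control.val {E : Type*} [NormedAddCommGroup E] (u : Control E) (t : ℝ) : E :=
  (show Lp E ⊤ (volume.restrict (Icc (0 : ℝ) 1)) from u) t

/-- The pairing `⟨v | u⟩ = ∫₀¹ ⟨v(t) | u(t)⟩ dt` of `v ∈ L¹([0,1]; E*)` with a control `u`. -/
def Control.pairing {E : Type*} [NormedAddCommGroup E] [NormedSpace ℝ E]
    (v : Lp (E →L[ℝ] ℝ) 1 (volume.restrict (Icc (0 : ℝ) 1))) (u : Control E) : ℝ :=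
  ∫ t in Icc (0 : ℝ) 1, v t (u.val t)

/-- The weak* topology of `L^∞([0,1]; E)` as the dual of `L¹([0,1]; E*)`: the coarsest topology
for which all the pairings are continuous. -/
abbrev weakStarTopology (E : Type*) [NormedAddCommGroup E] [NormedSpace ℝ E] :
    TopologicalSpace (Control E) :=
  ⨅ v : Lp (E →L[ℝ] ℝ) 1 (volume.restrict (Icc (0 : ℝ) 1)),
    TopologicalSpace.induced (Control.pairing v) inferInstance

/-- Weak* convergence of a sequence of controls. -/
def Control.WeakStarConverges {E : Type*} [NormedAddCommGroup E] [NormedSpace ℝ E]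
    (u : ℕ → Control E) (w : Control E) : Prop :=
  ∀ v : Lp (E →L[ℝ] ℝ) 1 (volume.restrict (Icc (0 : ℝ) 1)),
    Tendsto (fun n => Control.pairing v (u n)) atTop (𝓝 (Control.pairing v w))

/-- The sequential weak* topology on the space of controls: a set of controls is open iff it
eventually contains every sequence that weakly* converges to one of its points. It is finer than
`weakStarTopology E`. -/
instance {E : Type*} [NormedAddCommGroup E] [NormedSpace ℝ E] : TopologicalSpace (Control E) :=
  seqTopology Control.WeakStarConverges

/-- `γ : [0,1] → M` (values outside `[0,1]` are irrelevant) is a solution of the Cauchy problem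
`γ'(t) = f|_{γ(t)}[u(t)]`, `γ(0) = o`: it starts at `o`, it is absolutely continuous (continuous,
and absolutely continuous in every chart), and it satisfies the differential equation at almost
every time. -/
structure IsCauchySolution {m : ℕ} {E M : Type*} [NormedAddCommGroup E] [NormedSpace ℝ E]
    [TopologicalSpace M] [ChartedSpace (EuclideanSpace ℝ (Fin m)) M]
    (o : M) (f : LipSection m E M) (u : Control E) (γ : ℝ → M) : Prop where
  start : γ 0 = o
  continuousOn : ContinuousOn γ (Icc 0 1)
  absolutelyContinuous : ∀ e ∈ IsManifold.maximalAtlas (𝓡 m) ∞ M, ∀ a b : ℝ,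
    0 ≤ a → a ≤ b → b ≤ 1 → MapsTo γ (Icc a b) e.source →
      AbsolutelyContinuousOnInterval (fun t => e (γ t)) a b
  deriv_ae : ∀ᵐ t ∂(volume.restrict (Icc (0 : ℝ) 1)),
    HasMFDerivAt 𝓘(ℝ, ℝ) (𝓡 m) γ t ((1 : ℝ →L[ℝ] ℝ).smulRight (f.1 (γ t) (u.val t)))

/-- The domain of the End-point map: the triples `(o, f, u)` for which the Cauchy problem has a
solution on the whole of `[0,1]`. -/
def endPointDomain (m : ℕ) (E M : Type*) [NormedAddCommGroup E] [NormedSpace ℝ E]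
    [TopologicalSpace M] [ChartedSpace (EuclideanSpace ℝ (Fin m)) M] :
    Set (M × LipSection m E M × Control E) :=
  {x | ∃ γ : ℝ → M, IsCauchySolution x.1 x.2.1 x.2.2 γ}

/-- The End-point map `End(o, f, u) = γ(1)`, where `γ` is the solution of the Cauchy problem. -/
def endPoint {m : ℕ} {E M : Type*} [NormedAddCommGroup E] [NormedSpace ℝ E]
    [TopologicalSpace M] [ChartedSpace (EuclideanSpace ℝ (Fin m)) M]
    (x : endPointDomain m E M) : M :=
  Classical.choose x.2 1

end

/-! In a chart the Cauchy problem becomes x(t) = x(a) + ∫ G(x) u with G Lipschitz. Two solutions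
differ by at most a constant times the sum of three errors: the distance of the initial points, the
uniform distance of the fields, and the supremum of |∫_s^t (u - u')| over intervals
(`IsIntegralSolution.norm_sub_le`). The third error, unlike ‖u - u'‖, becomes small under weak*
convergence of bounded controls, because their primitives are equi-Lipschitz
(`Control.eventually_norm_integral_sub_le`). The constant depends only on bounds for the fields and
the controls. A convergent sequence has such bounds, by Banach–Steinhaus for controls and by the
uniform Lipschitz condition together with pointwise convergence for sections.

A product of sequential topologies need not be sequential, so convergent sequences alone do not give
joint continuity, and neighbourhoods in the two factors need not carry uniform bounds. Explicit
neighbourhoods are used instead (`chainReach`): the points reached from the centre by finitely many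
steps, where step n admits data bounded by C n → ∞ with tolerance δ n > 0. Their union is open
because the bound of any convergent sequence is below C n for large n. If δ n is small enough
relative to C n, step n moves the solution by at most η 2^{-(n+2)}, so a chain of any length moves
it by at most η. Sections and controls advance along their chains simultaneously, and this settles
the product topology (`IsSolutionOn.stableOn_of_chart`).

A subdivision of [0,1] into pieces lying in charts makes stability global (`IsSolutionOn.stableOn`).
For uniformity on a weak*-compact set, stability is proved for a filter of controls that also sees
weak* neighbourhoods inside bounded sets (`Control.boundedWeakStarNhds`). Weak*-compact sets are
bounded, so a finite cover concludes. -/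

/-! ### Radial retraction onto a ball. -/

/-- Radial retraction of a normed space onto the closed ball of centre `c` and radius `r`. -/
noncomputable def radialRetraction {X : Type*} [NormedAddCommGroup X] [NormedSpace ℝ X]
    (c : X) (r : ℝ) (x : X) : X :=
  c + (r / max r ‖x - c‖) • (x - c)

section RadialRetraction

variable {X : Type*} [NormedAddCommGroup X] [NormedSpace ℝ X] {c : X} {r : ℝ}

theorem radialRetraction_of_mem (hr : 0 < r) {x : X} (hx : x ∈ Metric.closedBall c r) :
    radialRetraction c r x = x := by
  have h : ‖x - c‖ ≤ r := by simpa [dist_eq_norm] using hx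
  simp [radialRetraction, max_eq_left h, div_self hr.ne']

theorem radialRetraction_mem (hr : 0 < r) (x : X) :
    radialRetraction c r x ∈ Metric.closedBall c r := by
  have hm : 0 < max r ‖x - c‖ := lt_max_of_lt_left hr
  rw [mem_closedBall_iff_norm, radialRetraction, add_sub_cancel_left, norm_smul, Real.norm_eq_abs,
    abs_of_nonneg (by positivity), div_mul_eq_mul_div, div_le_iff₀ hm]
  gcongr
  exact le_max_right _ _

/-- One term is x - y scaled by at most 1, the other is the change of scaling factor applied to the
vector closer to c; each costs at most ‖x - y‖. -/
theorem norm_radialRetraction_sub_le (hr : 0 < r) (x y : X) :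
    ‖radialRetraction c r x - radialRetraction c r y‖ ≤ 2 * ‖x - y‖ := by
  wlog hxy : ‖x - c‖ ≤ ‖y - c‖ generalizing x y
  · rw [norm_sub_rev, norm_sub_rev x y]
    exact this y x (le_of_not_ge hxy)
  set a := max r ‖x - c‖ with ha
  set b := max r ‖y - c‖ with hb
  have ha0 : 0 < a := lt_max_of_lt_left hr
  have hb0 : 0 < b := lt_max_of_lt_left hr
  have hab : a ≤ b := max_le_max le_rfl hxy
  have hba : b - a ≤ ‖x - y‖ := by
    have h1 : b - a ≤ ‖y - c‖ - ‖x - c‖ := by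
      rcases le_total r ‖y - c‖ with h | h
      · rw [hb, max_eq_right h]
        linarith [le_max_right r ‖x - c‖]
      · rw [hb, max_eq_left h]
        linarith [le_max_left r ‖x - c‖]
    have h2 := norm_sub_norm_le (y - c) (x - c)
    rw [sub_sub_sub_cancel_right, norm_sub_rev y x] at h2
    linarith
  have key : radialRetraction c r x - radialRetraction c r y
      = (r / b) • (x - y) + (r / a - r / b) • (x - c) := by
    simp only [radialRetraction, ← ha, ← hb]
    module
  rw [key]
  have h1 : ‖(r / b) • (x - y)‖ ≤ ‖x - y‖ := by
    rw [norm_smul, Real.norm_eq_abs, abs_of_nonneg (by positivity)]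
    have : r / b ≤ 1 := (div_le_one hb0).2 (le_max_left _ _)
    exact mul_le_of_le_one_left (norm_nonneg _) this
  have h2 : ‖(r / a - r / b) • (x - c)‖ ≤ ‖x - y‖ := by
    have e : r / a - r / b = (r / b) * ((b - a) / a) := by field_simp
    have hn : 0 ≤ (r / b) * ((b - a) / a) :=
      mul_nonneg (by positivity) (div_nonneg (by linarith) ha0.le)
    rw [norm_smul, Real.norm_eq_abs, e, abs_of_nonneg hn]
    have h3 : r / b ≤ 1 := (div_le_one hb0).2 (le_max_left _ _)
    calc r / b * ((b - a) / a) * ‖x - c‖ ≤ 1 * ((b - a) / a) * a := by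
          have h4 : 0 ≤ (b - a) / a := div_nonneg (by linarith) ha0.le
          gcongr
          exact le_max_right _ _
      _ = b - a := by field_simp
      _ ≤ _ := hba
  linarith [norm_add_le ((r / b) • (x - y)) ((r / a - r / b) • (x - c))]

end RadialRetraction

/-! ### Controlled integral equations in a normed space. -/

/-- Integral form of Grönwall's inequality. -/
theorem le_mul_exp_of_le_add_integral {φ : ℝ → ℝ} {a b A k : ℝ} (hφ : ContinuousOn φ (Icc a b))
    (hk : 0 ≤ k) (h : ∀ t ∈ Icc a b, φ t ≤ A + k * ∫ s in a..t, φ s) :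
    ∀ t ∈ Icc a b, φ t ≤ A * Real.exp (k * (t - a)) := by
  intro t ht
  have hab : a ≤ b := ht.1.trans ht.2
  rcases hk.eq_or_lt with rfl | hk
  · simpa using h t ht
  have hint : ∀ x ∈ Icc a b, IntervalIntegrable φ volume a x := fun x hx =>
    (hφ.mono (by rw [uIcc_of_le hx.1]; exact Icc_subset_Icc_right hx.2)).intervalIntegrable
  have hder : ∀ x ∈ Ico a b, HasDerivWithinAt (fun x => ∫ s in a..x, φ s) (φ x) (Ici x) x := by
    intro x hx
    have hx' := Ico_subset_Icc_self hx
    have hn : Ioc x b ∈ 𝓝[>] x := Ioc_mem_nhdsGT hx.2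
    refine intervalIntegral.integral_hasDerivWithinAt_right (hint x hx') ?_ ?_
    · exact ⟨Icc a b, mem_of_superset hn fun y hy => ⟨hx.1.trans hy.1.le, hy.2⟩,
        hφ.aestronglyMeasurable measurableSet_Icc⟩
    · exact (hφ x hx').mono_of_mem_nhdsWithin
        (mem_of_superset hn fun y hy => ⟨hx.1.trans hy.1.le, hy.2⟩)
  have hcont : ContinuousOn (fun x => ∫ s in a..x, φ s) (Icc a b) := by
    have := intervalIntegral.continuousOn_primitive_interval
      (μ := volume) (f := φ) (a := a) (b := b)
      (by rw [uIcc_of_le hab]; exact hφ.integrableOn_Icc)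
    rwa [uIcc_of_le hab] at this
  -- The primitive Φ of φ satisfies Φ(a) = 0 and Φ' ≤ kΦ + A, so the differential form of Grönwall
  -- applies to it. The case k = 0 was separated because the bound divides by k.
  have hg := le_gronwallBound_of_liminf_deriv_right_le (δ := 0) (K := k) (ε := A) hcont
    (fun x hx r hr => (hder x hx).liminf_right_slope_le hr) (by simp)
    (fun x hx => by linarith [h x (Ico_subset_Icc_self hx)]) t ht
  rw [gronwallBound_of_K_ne_0 hk.ne'] at hg
  have h3 := h t ht
  have h4 : k * ∫ s in a..t, φ s ≤ A * (Real.exp (k * (t - a)) - 1) := by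
    calc _ ≤ k * (0 * Real.exp (k * (t - a)) + A / k * (Real.exp (k * (t - a)) - 1)) := by gcongr
      _ = _ := by field_simp; ring
  linarith

/-- `u` is measurable and essentially bounded by `C` on `[a, b]`. -/
structure EssBoundedOn {E : Type*} [NormedAddCommGroup E] (u : ℝ → E) (C a b : ℝ) : Prop where
  aestronglyMeasurable : AEStronglyMeasurable u (volume.restrict (Icc a b))
  norm_le : ∀ᵐ t ∂(volume.restrict (Icc a b)), ‖u t‖ ≤ C

/-- `x` is a continuous solution on `[a, b]` of the integral form of `x' = G(x) u`. -/
structure IsIntegralSolution {E X : Type*} [NormedAddCommGroup E] [NormedSpace ℝ E]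
    [NormedAddCommGroup X] [NormedSpace ℝ X] (G : X → E →L[ℝ] X) (u : ℝ → E) (x : ℝ → X)
    (a b : ℝ) : Prop where
  continuousOn : ContinuousOn x (Icc a b)
  eq_add_integral : ∀ t ∈ Icc a b, x t = x a + ∫ s in a..t, G (x s) (u s)

section EssBoundedOn

variable {E : Type*} [NormedAddCommGroup E] {a b c d C : ℝ} {u v : ℝ → E}

theorem EssBoundedOn.mono (hu : EssBoundedOn u C a b) (h : Icc c d ⊆ Icc a b) :
    EssBoundedOn u C c d :=
  ⟨hu.1.mono_set h, ae_mono (Measure.restrict_mono_set _ h) hu.2⟩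

theorem EssBoundedOn.weaken (hu : EssBoundedOn u C a b) {D : ℝ} (h : C ≤ D) :
    EssBoundedOn u D a b :=
  ⟨hu.1, hu.2.mono fun _ ht => ht.trans h⟩

theorem EssBoundedOn.sub (hu : EssBoundedOn u C a b) {D : ℝ} (hv : EssBoundedOn v D a b) :
    EssBoundedOn (fun t => u t - v t) (C + D) a b := by
  refine ⟨hu.1.sub hv.1, ?_⟩
  filter_upwards [hu.2, hv.2] with t h1 h2
  exact (norm_sub_le _ _).trans (add_le_add h1 h2)

theorem EssBoundedOn.ae_mem (hu : EssBoundedOn u C a b) :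
    ∀ᵐ t, t ∈ Icc a b → ‖u t‖ ≤ C :=
  (ae_restrict_iff' measurableSet_Icc).1 hu.2

end EssBoundedOn

section ControlledODE

variable {E X : Type*} [NormedAddCommGroup E] [NormedSpace ℝ E]
  [NormedAddCommGroup X] [NormedSpace ℝ X] {a b c d C M : ℝ} {u : ℝ → E}

theorem EssBoundedOn.intervalIntegrable_apply {h : ℝ → E →L[ℝ] X} (hu : EssBoundedOn u C a b)
    (hh : ContinuousOn h (Icc a b)) {s t : ℝ} (hs : s ∈ Icc a b) (ht : t ∈ Icc a b) :
    IntervalIntegrable (fun r => h r (u r)) volume s t := by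
  have hint : IntegrableOn (fun r => h r (u r)) (Icc a b) := by
    obtain ⟨M, hM⟩ := isCompact_Icc.exists_bound_of_continuousOn hh
    have hm : AEStronglyMeasurable (fun r => h r (u r)) (volume.restrict (Icc a b)) :=
      (isBoundedBilinearMap_apply (𝕜 := ℝ) (E := E) (F := X)).continuous.comp_aestronglyMeasurable
        ((hh.aestronglyMeasurable measurableSet_Icc).prodMk hu.1)
    refine ⟨hm, HasFiniteIntegral.of_bounded (C := M * C) ?_⟩
    filter_upwards [hu.2, ae_restrict_mem measurableSet_Icc] with r h1 h2
    exact ((h r).le_opNorm _).trans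
      (mul_le_mul (hM r h2) h1 (norm_nonneg _) ((norm_nonneg _).trans (hM r h2)))
  rw [intervalIntegrable_iff]
  exact hint.mono_set (uIoc_subset_uIcc.trans (uIcc_subset_Icc hs ht))

theorem EssBoundedOn.intervalIntegrable (hu : EssBoundedOn u C a b)
    {s t : ℝ} (hs : s ∈ Icc a b) (ht : t ∈ Icc a b) : IntervalIntegrable u volume s t :=
  hu.intervalIntegrable_apply (h := fun _ => ContinuousLinearMap.id ℝ E) continuousOn_const hs ht

theorem EssBoundedOn.norm_integral_apply_le {h : ℝ → E →L[ℝ] X} (hu : EssBoundedOn u C a b)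
    {s t : ℝ} (hs : s ∈ Icc a b) (ht : t ∈ Icc a b) (hM : ∀ r ∈ uIcc s t, ‖h r‖ ≤ M) :
    ‖∫ r in s..t, h r (u r)‖ ≤ M * C * |t - s| := by
  refine intervalIntegral.norm_integral_le_of_norm_le_const_ae ?_
  filter_upwards [hu.ae_mem] with r hr hst
  have h2 := hM r (uIoc_subset_uIcc hst)
  exact ((h r).le_opNorm _).trans
    (mul_le_mul h2 (hr ((uIcc_subset_Icc hs ht) (uIoc_subset_uIcc hst)))
      (norm_nonneg _) ((norm_nonneg _).trans h2))

theorem EssBoundedOn.norm_integral_le (hu : EssBoundedOn u C a b)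
    {s t : ℝ} (hs : s ∈ Icc a b) (ht : t ∈ Icc a b) :
    ‖∫ r in s..t, u r‖ ≤ C * |t - s| := by
  simpa using hu.norm_integral_apply_le (h := fun _ => ContinuousLinearMap.id ℝ E) (M := 1) hs ht
    (fun _ _ => ContinuousLinearMap.norm_id_le)

/-- If the integrals of `w` over all intervals are small, then so are those of `h w`, for `h`
bounded and Lipschitz. -/
theorem EssBoundedOn.norm_integral_apply_le_of_lipschitz [CompleteSpace E]
    [CompleteSpace X]
    {w : ℝ → E} {h : ℝ → E →L[ℝ] X}
    (hw : EssBoundedOn w C a b) (hC : 0 ≤ C) (hc : 0 ≤ c)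
    (hlip : ∀ s ∈ Icc a b, ∀ t ∈ Icc a b, ‖h s - h t‖ ≤ c * |s - t|)
    (hM : ∀ t ∈ Icc a b, ‖h t‖ ≤ M)
    (hd : ∀ s ∈ Icc a b, ∀ t ∈ Icc a b, ‖∫ r in s..t, w r‖ ≤ d) :
    ∀ t ∈ Icc a b, ‖∫ r in a..t, h r (w r)‖ ≤ d * (M + c * (t - a)) := by
  intro t ht
  have hab : a ≤ b := ht.1.trans ht.2
  have ha : a ∈ Icc a b := left_mem_Icc.2 hab
  have hd0 : 0 ≤ d := (norm_nonneg _).trans (hd a ha a ha)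
  have hcont : ContinuousOn h (Icc a b) := by
    have : LipschitzOnWith c.toNNReal h (Icc a b) := LipschitzOnWith.of_dist_le_mul fun s hs t ht => by
      rw [dist_eq_norm, Real.dist_eq, Real.coe_toNNReal _ hc]
      exact hlip s hs t ht
    exact this.continuousOn
  -- Integration by parts for an h that is only Lipschitz: F is the integral minus the boundary
  -- term, and plays the role of -∫ h' W with W the primitive of w. Its increments are at most c d
  -- (z - s) plus a quadratic term.
  set F : ℝ → X := fun t => (∫ r in a..t, h r (w r)) - h t (∫ r in a..t, w r) with hF
  have hFdiff : ∀ s ∈ Icc a b, ∀ z ∈ Icc a b, s ≤ z →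
      ‖F z - F s‖ ≤ c * d * (z - s) + c * C * (z - s) * (z - s) := by
    intro s hs z hz hsz
    have e : F z - F s = (∫ r in s..z, (h r - h z) (w r)) + (h s - h z) (∫ r in a..s, w r) := by
      have e1 := intervalIntegral.integral_interval_sub_left
        (hw.intervalIntegrable_apply hcont ha hz) (hw.intervalIntegrable_apply hcont ha hs)
      have e2 : (∫ r in a..z, w r) = (∫ r in a..s, w r) + ∫ r in s..z, w r :=
        (intervalIntegral.integral_add_adjacent_intervals (hw.intervalIntegrable ha hs)
          (hw.intervalIntegrable hs hz)).symm
      have e3 : (∫ r in s..z, (h r - h z) (w r))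
          = (∫ r in s..z, h r (w r)) - h z (∫ r in s..z, w r) := by
        rw [← ContinuousLinearMap.intervalIntegral_comp_comm _ (hw.intervalIntegrable hs hz),
          ← intervalIntegral.integral_sub (hw.intervalIntegrable_apply hcont hs hz)
            (hw.intervalIntegrable_apply continuousOn_const hs hz)]
        rfl
      rw [e3, ← e1]
      simp only [hF, e2, map_add, sub_apply]
      abel
    rw [e]
    have h1 : ‖∫ r in s..z, (h r - h z) (w r)‖ ≤ c * (z - s) * C * |z - s| := by
      refine hw.norm_integral_apply_le (h := fun r => h r - h z) hs hz fun r hr => ?_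
      rw [uIcc_of_le hsz] at hr
      refine (hlip r ⟨hs.1.trans hr.1, hr.2.trans hz.2⟩ z hz).trans ?_
      rw [abs_sub_comm, abs_of_nonneg (by linarith [hr.2])]
      gcongr
      exact hr.1
    have h2 : ‖(h s - h z) (∫ r in a..s, w r)‖ ≤ c * (z - s) * d := by
      refine ((h s - h z).le_opNorm _).trans ?_
      have := hlip s hs z hz
      rw [abs_sub_comm, abs_of_nonneg (by linarith)] at this
      exact mul_le_mul this (hd a ha s hs) (norm_nonneg _)
        (mul_nonneg hc (by linarith))
    rw [abs_of_nonneg (by linarith : 0 ≤ z - s)] at h1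
    calc _ ≤ _ := norm_add_le _ _
      _ ≤ _ := add_le_add h1 h2
      _ = _ := by ring
  have hFcont : ContinuousOn F (Icc a b) := by
    have : LipschitzOnWith (c * d + c * C * (b - a)).toNNReal F (Icc a b) := by
      refine LipschitzOnWith.of_dist_le_mul fun s hs t ht => ?_
      have hn : 0 ≤ c * d + c * C * (b - a) :=
        add_nonneg (mul_nonneg hc hd0) (mul_nonneg (mul_nonneg hc hC) (by linarith))
      rw [Real.coe_toNNReal _ hn]
      wlog hst : s ≤ t generalizing s t
      · rw [dist_comm, dist_comm s t]
        exact this t ht s hs (le_of_not_ge hst)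
      rw [dist_comm, dist_comm s t, dist_eq_norm, Real.dist_eq, abs_of_nonneg (by linarith)]
      refine (hFdiff s hs t ht hst).trans ?_
      have : t - s ≤ b - a := by linarith [hs.1, ht.2]
      have h0 : 0 ≤ t - s := by linarith
      have := mul_le_mul_of_nonneg_left this (mul_nonneg (mul_nonneg hc hC) h0)
      linarith
    exact this.continuousOn
  -- The quadratic term disappears in the right slope, which leaves slope at most c d. The bound C
  -- on w therefore does not enter the result.
  have hFb : ‖F t‖ ≤ c * d * (t - a) := by
    refine image_le_of_liminf_slope_right_le_deriv_boundary (f := fun t => ‖F t‖)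
      (B := fun t => c * d * (t - a)) (B' := fun _ => c * d) hFcont.norm (by simp [hF])
      (by fun_prop) (fun x _ => ?_) (fun x hx r hr => ?_) ht
    · simpa using (((hasDerivAt_id x).sub_const a).const_mul (c * d)).hasDerivWithinAt
    · have hlim : Tendsto (fun z => c * d + c * C * (z - x)) (𝓝[>] x) (𝓝 (c * d)) := by
        have : Tendsto (fun z => c * d + c * C * (z - x)) (𝓝 x) (𝓝 (c * d + c * C * (x - x))) :=
          (by fun_prop : Continuous fun z => c * d + c * C * (z - x)).tendsto x
        rw [sub_self, mul_zero, add_zero] at this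
        exact this.mono_left nhdsWithin_le_nhds
      refine Eventually.frequently ?_
      filter_upwards [hlim.eventually_lt_const hr, Ioc_mem_nhdsGT hx.2] with z hz hzx
      refine lt_of_le_of_lt ?_ hz
      have hzx0 : 0 < z - x := by linarith [hzx.1]
      rw [slope_def_field, div_le_iff₀ hzx0]
      refine (norm_sub_norm_le _ _).trans ?_
      refine (hFdiff x (Ico_subset_Icc_self hx) z ⟨hx.1.trans hzx.1.le, hzx.2⟩ hzx.1.le).trans ?_
      linarith
  have e : (∫ r in a..t, h r (w r)) = F t + h t (∫ r in a..t, w r) := by simp [hF]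
  rw [e]
  calc _ ≤ ‖F t‖ + ‖h t (∫ r in a..t, w r)‖ := norm_add_le _ _
    _ ≤ c * d * (t - a) + M * d := by
      refine add_le_add hFb (((h t).le_opNorm _).trans ?_)
      exact mul_le_mul (hM t ht) (hd a ha t ht) (norm_nonneg _)
        ((norm_nonneg _).trans (hM t ht))
    _ = _ := by ring

end ControlledODE

section LipschitzControlledODE

variable {E X : Type*} [NormedAddCommGroup E] [NormedSpace ℝ E]
  [NormedAddCommGroup X] [NormedSpace ℝ X] {a b C L M : ℝ} {u u' : ℝ → E} {G G' : X → E →L[ℝ] X}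
  {x x' : ℝ → X}

theorem continuous_of_norm_sub_le (hG : ∀ y z, ‖G y - G z‖ ≤ L * ‖y - z‖) : Continuous G := by
  have : LipschitzWith L.toNNReal G := LipschitzWith.of_dist_le_mul fun y z => by
    rw [dist_eq_norm, dist_eq_norm]
    refine (hG y z).trans ?_
    gcongr
    exact Real.le_coe_toNNReal L
  exact this.continuous

theorem IsIntegralSolution.sub_eq (hx : IsIntegralSolution G u x a b) (hu : EssBoundedOn u C a b)
    (hG : Continuous G) {s t : ℝ} (hs : s ∈ Icc a b) (ht : t ∈ Icc a b) :
    x t - x s = ∫ r in s..t, G (x r) (u r) := by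
  have ha : a ∈ Icc a b := left_mem_Icc.2 (hs.1.trans hs.2)
  have hc : ContinuousOn (fun r => G (x r)) (Icc a b) := hG.comp_continuousOn hx.1
  rw [hx.2 t ht, hx.2 s hs, add_sub_add_left_eq_sub, intervalIntegral.integral_interval_sub_left
    (hu.intervalIntegrable_apply hc ha ht) (hu.intervalIntegrable_apply hc ha hs)]

/-- Quantitative dependence of the solutions of `x' = G(x) u` on the initial value, on `G` and on
the primitive of `u`. -/
theorem IsIntegralSolution.norm_sub_le [CompleteSpace E] [CompleteSpace X]
    (hx : IsIntegralSolution G u x a b)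
    (hx' : IsIntegralSolution G' u' x' a b) (hab : a ≤ b) (hC : 0 ≤ C) (hL : 0 ≤ L) (hM : 0 ≤ M)
    (hG : Continuous G) (hG' : ∀ y z, ‖G' y - G' z‖ ≤ L * ‖y - z‖) (hGM : ∀ y, ‖G' y‖ ≤ M)
    {δ d : ℝ} (hGG : ∀ y, ‖G y - G' y‖ ≤ δ) (hu : EssBoundedOn u C a b)
    (hu' : EssBoundedOn u' C a b)
    (hd : ∀ s ∈ Icc a b, ∀ t ∈ Icc a b, ‖∫ r in s..t, (u r - u' r)‖ ≤ d) :
    ∀ t ∈ Icc a b, ‖x t - x' t‖ ≤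
      (‖x a - x' a‖ + δ * C * (b - a) + d * (M + L * (M * C) * (b - a)))
        * Real.exp (L * C * (t - a)) := by
  have ha : a ∈ Icc a b := left_mem_Icc.2 hab
  have hGc' := continuous_of_norm_sub_le hG'
  have hδ : 0 ≤ δ := (norm_nonneg _).trans (hGG 0)
  have hd0 : 0 ≤ d := (norm_nonneg _).trans (hd a ha a ha)
  have c1 : ContinuousOn (fun r => G (x r)) (Icc a b) := hG.comp_continuousOn hx.1
  have c2 : ContinuousOn (fun r => G' (x r)) (Icc a b) := hGc'.comp_continuousOn hx.1
  have c3 : ContinuousOn (fun r => G' (x' r)) (Icc a b) := hGc'.comp_continuousOn hx'.1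
  have hlip : ∀ s ∈ Icc a b, ∀ t ∈ Icc a b, ‖G' (x' s) - G' (x' t)‖ ≤ L * (M * C) * |s - t| := by
    intro s hs t ht
    refine (hG' _ _).trans ?_
    rw [hx'.sub_eq hu' hGc' ht hs, mul_assoc]
    gcongr
    exact hu'.norm_integral_apply_le (h := fun r => G' (x' r)) ht hs fun _ _ => hGM _
  have hE := (hu.sub hu').norm_integral_apply_le_of_lipschitz (add_nonneg hC hC)
    (mul_nonneg hL (mul_nonneg hM hC)) hlip (fun t _ => hGM _) hd
  refine le_mul_exp_of_le_add_integral (hx.1.sub hx'.1).norm (mul_nonneg hL hC) fun t ht => ?_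
  have hle : t - a ≤ b - a := by linarith [ht.2]
  have i1 := hu.intervalIntegrable_apply c1 ha ht
  have i2 := hu.intervalIntegrable_apply c2 ha ht
  have i3 := hu'.intervalIntegrable_apply c3 ha ht
  have i4 := hu.intervalIntegrable_apply c3 ha ht
  -- The fields are compared along x, then G' is compared at x and x' (the term fed back into
  -- Grönwall), then the controls are compared along x'. In the last term r ↦ G'(x' r) is Lipschitz
  -- with constant L(MC), since x' has speed at most MC; so smallness of the primitive of u - u'
  -- suffices.
  have e : x t - x' t = (x a - x' a) + (∫ r in a..t, (G (x r) - G' (x r)) (u r))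
      + (∫ r in a..t, (G' (x r) - G' (x' r)) (u r)) + ∫ r in a..t, G' (x' r) (u r - u' r) := by
    simp only [sub_apply, map_sub]
    rw [intervalIntegral.integral_sub i1 i2, intervalIntegral.integral_sub i2 i4,
      intervalIntegral.integral_sub i4 i3, hx.2 t ht, hx'.2 t ht]
    abel
  have b1 : ‖∫ r in a..t, (G (x r) - G' (x r)) (u r)‖ ≤ δ * C * (b - a) := by
    refine (hu.norm_integral_apply_le (h := fun r => G (x r) - G' (x r)) ha ht
      fun r _ => hGG _).trans ?_
    rw [abs_of_nonneg (by linarith [ht.1])]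
    gcongr
  have b2 : ‖∫ r in a..t, (G' (x r) - G' (x' r)) (u r)‖ ≤ L * C * ∫ r in a..t, ‖x r - x' r‖ := by
    rw [← intervalIntegral.integral_const_mul]
    refine intervalIntegral.norm_integral_le_of_norm_le ht.1 ?_ ?_
    · filter_upwards [hu.ae_mem] with r hr hrt
      refine ((G' (x r) - G' (x' r)).le_opNorm _).trans ?_
      calc _ ≤ (L * ‖x r - x' r‖) * C :=
            mul_le_mul (hG' _ _) (hr ⟨hrt.1.le, hrt.2.trans ht.2⟩) (norm_nonneg _) (by positivity)
        _ = _ := by ring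
    · refine ContinuousOn.intervalIntegrable ?_
      rw [uIcc_of_le ht.1]
      exact continuousOn_const.mul
        ((hx.1.sub hx'.1).norm.mono (Icc_subset_Icc_right ht.2))
  have b3 : ‖∫ r in a..t, G' (x' r) (u r - u' r)‖ ≤ d * (M + L * (M * C) * (b - a)) := by
    refine (hE t ht).trans ?_
    gcongr
  rw [e]
  calc _ ≤ ‖x a - x' a‖ + ‖∫ r in a..t, (G (x r) - G' (x r)) (u r)‖
        + ‖∫ r in a..t, (G' (x r) - G' (x' r)) (u r)‖ + ‖∫ r in a..t, G' (x' r) (u r - u' r)‖ :=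
        norm_add₄_le
    _ ≤ _ := by linarith

/-- Picard iteration on continuous curves. The n-th iterate has Lipschitz constant (LC(b - a))^n /
n!, so some iterate contracts on the whole interval and its fixed point is fixed by the Picard map
itself. -/
theorem exists_isIntegralSolution [CompleteSpace X] (hab : a ≤ b) (hL : 0 ≤ L) (hC : 0 ≤ C)
    (hG : ∀ y z, ‖G y - G z‖ ≤ L * ‖y - z‖) (hu : EssBoundedOn u C a b) (x₀ : X) :
    ∃ x, IsIntegralSolution G u x a b ∧ x a = x₀ := by
  have ha : a ∈ Icc a b := left_mem_Icc.2 hab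
  have hGc := continuous_of_norm_sub_le hG
  let ext : C(Icc a b, X) → ℝ → X := fun α s => α (projIcc a b hab s)
  have hext : ∀ α, Continuous (ext α) := fun α => α.continuous.comp continuous_projIcc
  have hcont : ∀ α, ContinuousOn (fun s => G (ext α s)) (Icc a b) := fun α =>
    (hGc.comp (hext α)).continuousOn
  let T : C(Icc a b, X) → C(Icc a b, X) := fun α =>
    { toFun := fun t => x₀ + ∫ s in a..t, G (ext α s) (u s)
      continuous_toFun := by
        have h := intervalIntegral.continuousOn_primitive_interval' (b₁ := a) (b₂ := b) (a := a)
          (hu.intervalIntegrable_apply (hcont α) ha (right_mem_Icc.2 hab))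
          (by rw [uIcc_of_le hab]; exact ha)
        rw [uIcc_of_le hab] at h
        exact continuous_const.add (continuousOn_iff_continuous_domRestrict.1 h) }
  have hT : ∀ (n : ℕ) (α β : C(Icc a b, X)) (t : Icc a b),
      ‖(T^[n] α) t - (T^[n] β) t‖ ≤ (L * C * (t - a)) ^ n / n.factorial * dist α β := by
    intro n
    induction n with
    | zero =>
      intro α β t
      simpa [dist_eq_norm] using ContinuousMap.dist_apply_le_dist (f := α) (g := β) t
    | succ n ih =>
      intro α β t
      rw [Function.iterate_succ_apply', Function.iterate_succ_apply']
      set α' := T^[n] α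
      set β' := T^[n] β
      have e : (T α') t - (T β') t = ∫ s in a..t, (G (ext α' s) - G (ext β' s)) (u s) := by
        simp only [sub_apply]
        rw [intervalIntegral.integral_sub (hu.intervalIntegrable_apply (hcont α') ha t.2)
          (hu.intervalIntegrable_apply (hcont β') ha t.2)]
        simp [T]
      rw [e]
      have hi : ∫ s in a..(t : ℝ), (L * C) ^ (n + 1) / n.factorial * dist α β * (s - a) ^ n
          = (L * C * (t - a)) ^ (n + 1) / (n + 1).factorial * dist α β := by
        rw [intervalIntegral.integral_const_mul,
          intervalIntegral.integral_comp_sub_right (fun s => s ^ n) a, integral_pow,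
          Nat.factorial_succ]
        push_cast
        field_simp
        rw [mul_pow (L * C)]
        simp
        ring
      rw [← hi]
      refine intervalIntegral.norm_integral_le_of_norm_le t.2.1 ?_
        (Continuous.intervalIntegrable (by fun_prop) _ _)
      filter_upwards [hu.ae_mem] with s hs hst
      have hsI : s ∈ Icc a b := ⟨hst.1.le, hst.2.trans t.2.2⟩
      refine ((G (ext α' s) - G (ext β' s)).le_opNorm _).trans ?_
      have h1 := ih α β (projIcc a b hab s)
      rw [projIcc_of_mem hab hsI] at h1
      have h2 := hG (ext α' s) (ext β' s)
      simp only [ext, projIcc_of_mem hab hsI] at h2 ⊢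
      calc _ ≤ (L * ((L * C * (s - a)) ^ n / n.factorial * dist α β)) * C := by
            refine mul_le_mul (h2.trans (mul_le_mul_of_nonneg_left h1 hL)) (hs hsI)
              (norm_nonneg _) ?_
            have : 0 ≤ s - a := by linarith [hsI.1]
            positivity
        _ = _ := by rw [mul_pow]; ring
  obtain ⟨n, hn⟩ := ((FloorSemiring.tendsto_pow_div_factorial_atTop
    (L * C * (b - a))).eventually_lt_const (zero_lt_one)).exists
  have hba : 0 ≤ b - a := by linarith
  set K := (L * C * (b - a)) ^ n / n.factorial with hK
  have hK0 : 0 ≤ K := by positivity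
  have hcw : ContractingWith K.toNNReal (T^[n]) := by
    refine ⟨by rwa [Real.toNNReal_lt_one], LipschitzWith.of_dist_le_mul fun α β => ?_⟩
    rw [Real.coe_toNNReal _ hK0, ContinuousMap.dist_le (by positivity)]
    intro t
    rw [dist_eq_norm]
    refine (hT n α β t).trans ?_
    have h1 : (t : ℝ) - a ≤ b - a := by linarith [t.2.2]
    have h2 : 0 ≤ (t : ℝ) - a := by linarith [t.2.1]
    rw [hK]
    gcongr
  have : Nonempty C(Icc a b, X) := ⟨0⟩
  set α := hcw.fixedPoint (T^[n])
  have hα : T α = α := hcw.isFixedPt_fixedPoint_iterate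
  have hαt : ∀ t : Icc a b, α t = x₀ + ∫ s in a..t, G (ext α s) (u s) := fun t => by
    conv_lhs => rw [← hα]
    rfl
  have hxa : ext α a = x₀ := by
    have := hαt ⟨a, ha⟩
    simpa [ext, projIcc_of_mem hab ha] using this
  refine ⟨ext α, ⟨(hext α).continuousOn, fun t ht => ?_⟩, hxa⟩
  rw [hxa, ← hαt ⟨t, ht⟩]
  simp [ext, projIcc_of_mem hab ht]

end LipschitzControlledODE

/-! ### Weak* bounds and weak* convergence of controls. -/

namespace Control

section Basic

variable {E : Type*} [NormedAddCommGroup E]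

theorem exists_essBoundedOn (u : Control E) : ∃ C, 0 ≤ C ∧ EssBoundedOn u.val C 0 1 := by
  let w : Lp E ⊤ (volume.restrict (Icc (0 : ℝ) 1)) := u
  refine ⟨(eLpNorm w ⊤ (volume.restrict (Icc (0 : ℝ) 1))).toReal, ENNReal.toReal_nonneg,
    Lp.aestronglyMeasurable w, ?_⟩
  filter_upwards [ae_le_eLpNormEssSup (f := w) (μ := volume.restrict (Icc (0 : ℝ) 1))] with t ht
  rw [eLpNorm_exponent_top, ← toReal_enorm]
  refine ENNReal.toReal_mono ?_ ht
  have := (Lp.memLp w).2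
  rw [eLpNorm_exponent_top] at this
  exact this.ne

end Basic

variable {E : Type*} [NormedAddCommGroup E] [NormedSpace ℝ E]

theorem integrable_pairing (v : Lp (E →L[ℝ] ℝ) 1 (volume.restrict (Icc (0 : ℝ) 1)))
    {u : Control E} {C : ℝ} (hu : EssBoundedOn u.val C 0 1) :
    Integrable (fun t => v t (u.val t)) (volume.restrict (Icc (0 : ℝ) 1)) ∧
      |pairing v u| ≤ C * ‖v‖ := by
  have hv : Integrable v (volume.restrict (Icc (0 : ℝ) 1)) := L1.integrable_coeFn v
  have hb : ∀ᵐ t ∂(volume.restrict (Icc (0 : ℝ) 1)), ‖v t (u.val t)‖ ≤ C * ‖v t‖ := by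
    filter_upwards [hu.2] with t ht
    rw [mul_comm]
    exact ((v t).le_opNorm _).trans (by gcongr)
  refine ⟨(hv.norm.const_mul C).mono' ?_ hb, ?_⟩
  · exact (isBoundedBilinearMap_apply (𝕜 := ℝ) (E := E) (F := ℝ)).continuous.comp_aestronglyMeasurable
      (hv.1.prodMk hu.1)
  · rw [L1.norm_eq_integral_norm, ← integral_const_mul]
    exact norm_integral_le_of_norm_le (hv.norm.const_mul C) hb

/-- The functional on `L¹([0,1]; E*)` defined by a control. -/
noncomputable def toFunctional (u : Control E) :
    Lp (E →L[ℝ] ℝ) 1 (volume.restrict (Icc (0 : ℝ) 1)) →L[ℝ] ℝ :=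
  LinearMap.mkContinuousOfExistsBound
    { toFun := fun v => pairing v u
      map_add' := fun v w => by
        obtain ⟨C, -, hu⟩ := u.exists_essBoundedOn
        simp only [pairing]
        rw [← integral_add (integrable_pairing v hu).1 (integrable_pairing w hu).1]
        refine integral_congr_ae ?_
        filter_upwards [Lp.coeFn_add v w] with t ht
        rw [ht]
        rfl
      map_smul' := fun c v => by
        simp only [pairing, RingHom.id_apply, smul_eq_mul]
        rw [← integral_const_mul]
        refine integral_congr_ae ?_
        filter_upwards [Lp.coeFn_smul c v] with t ht
        rw [ht]
        rfl }
    (by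
      obtain ⟨C, -, hu⟩ := u.exists_essBoundedOn
      exact ⟨C, fun v => (integrable_pairing v hu).2⟩)

theorem toFunctional_apply (u : Control E)
    (v : Lp (E →L[ℝ] ℝ) 1 (volume.restrict (Icc (0 : ℝ) 1))) :
    u.toFunctional v = pairing v u := rfl

/-- Testing against step functions reads off the primitive of u, which is the only way weak*
information enters the differential equation. -/
theorem pairing_indicatorConstLp [CompleteSpace E] (u : Control E) (φ : E →L[ℝ] ℝ) {s t : ℝ}
    (hs : 0 ≤ s) (hst : s ≤ t) (ht : t ≤ 1) :
    pairing (indicatorConstLp 1 (measurableSet_Ioc : MeasurableSet (Ioc s t))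
      (measure_ne_top (volume.restrict (Icc (0 : ℝ) 1)) _) φ) u = φ (∫ r in s..t, u.val r) := by
  obtain ⟨C, -, hu⟩ := u.exists_essBoundedOn
  have hsub : Ioc s t ⊆ Icc 0 1 := fun r hr => ⟨hs.trans hr.1.le, hr.2.trans ht⟩
  rw [← ContinuousLinearMap.intervalIntegral_comp_comm _
    (hu.intervalIntegrable ⟨hs, hst.trans ht⟩ ⟨hs.trans hst, ht⟩),
    intervalIntegral.integral_of_le hst, pairing]
  have : (∫ r in Ioc s t, φ (u.val r))
      = ∫ r in Icc (0 : ℝ) 1, (Ioc s t).indicator (fun r => φ (u.val r)) r := by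
    rw [integral_indicator measurableSet_Ioc, Measure.restrict_restrict measurableSet_Ioc,
      inter_eq_self_of_subset_left hsub]
  rw [this]
  refine integral_congr_ae ?_
  filter_upwards [indicatorConstLp_coeFn (p := 1) (hs := measurableSet_Ioc (a := s) (b := t))
    (hμs := measure_ne_top (volume.restrict (Icc (0 : ℝ) 1)) _) (c := φ)] with r hr
  rw [hr]
  by_cases h : r ∈ Ioc s t <;> simp [h]

/-- Step functions show that the primitive of u is C-Lipschitz; by Lebesgue differentiation u is
almost everywhere its derivative, hence bounded by C. -/
theorem essBoundedOn_of_norm_toFunctional_le [CompleteSpace E] {u : Control E} {C : ℝ}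
    (hu : ‖u.toFunctional‖ ≤ C) : EssBoundedOn u.val C 0 1 := by
  have hC : 0 ≤ C := (norm_nonneg u.toFunctional).trans hu
  obtain ⟨D, -, hD⟩ := u.exists_essBoundedOn
  refine ⟨hD.1, ?_⟩
  have h01 : (0 : ℝ) ≤ 1 := zero_le_one
  have hlip : ∀ s t : ℝ, 0 ≤ s → s ≤ t → t ≤ 1 → ‖∫ r in s..t, u.val r‖ ≤ C * (t - s) := by
    intro s t hs hst ht
    refine NormedSpace.norm_le_dual_bound ℝ _ (mul_nonneg hC (by linarith)) fun φ => ?_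
    rw [← pairing_indicatorConstLp u φ hs hst ht, ← toFunctional_apply]
    refine (u.toFunctional.le_of_opNorm_le hu _).trans ?_
    rw [mul_assoc]
    gcongr
    refine norm_indicatorConstLp_le.trans ?_
    rw [mul_comm]
    gcongr
    simp only [ENNReal.toReal_one, div_one, Real.rpow_one]
    refine ENNReal.toReal_le_of_le_ofReal (by linarith) ?_
    exact (Measure.restrict_apply_le _ _).trans (by simp)
  rw [ae_restrict_iff' measurableSet_Icc]
  have hi : IntervalIntegrable u.val volume 0 1 :=
    hD.intervalIntegrable (left_mem_Icc.2 h01) (right_mem_Icc.2 h01)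
  have h0 : ∀ᵐ t : ℝ, t ≠ 0 := by simp [ae_iff, measure_singleton]
  have h1 : ∀ᵐ t : ℝ, t ≠ 1 := by simp [ae_iff, measure_singleton]
  filter_upwards [hi.ae_hasDerivAt_integral, h0, h1] with t ht ht0 ht1 htI
  rw [uIcc_of_le h01] at ht
  refine (ht htI 0 (left_mem_Icc.2 h01)).le_of_lip' hC ?_
  have hmem : Icc (0 : ℝ) 1 ∈ 𝓝 t := Icc_mem_nhds (htI.1.lt_of_ne' ht0) (htI.2.lt_of_ne ht1)
  filter_upwards [hmem] with s hs
  rw [intervalIntegral.integral_interval_sub_left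
    (hD.intervalIntegrable (left_mem_Icc.2 h01) hs)
    (hD.intervalIntegrable (left_mem_Icc.2 h01) htI)]
  rcases le_total s t with h | h
  · rw [intervalIntegral.integral_symm, norm_neg, Real.norm_eq_abs, abs_sub_comm,
      abs_of_nonneg (by linarith)]
    exact hlip s t hs.1 h htI.2
  · rw [Real.norm_eq_abs, abs_of_nonneg (by linarith)]
    exact hlip t s htI.1 h hs.2

/-- Pointwise bounded families of controls are uniformly bounded. -/
theorem exists_essBoundedOn_of_pairing_bounded [CompleteSpace E] {ι : Type*} (u : ι → Control E)
    (h : ∀ v, ∃ C, ∀ i, |pairing v (u i)| ≤ C) :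
    ∃ C, ∀ i, EssBoundedOn (u i).val C 0 1 := by
  obtain ⟨C, hC⟩ := banach_steinhaus (g := fun i => (u i).toFunctional) h
  exact ⟨C, fun i => essBoundedOn_of_norm_toFunctional_le (hC i)⟩

/-- Each pairing is weak* continuous, hence bounded on the compact set, so the uniform boundedness
principle applies. -/
theorem exists_essBoundedOn_of_isCompact [CompleteSpace E] {K : Set (Control E)}
    (hK : @IsCompact (Control E) (weakStarTopology E) K) :
    ∃ C, ∀ u ∈ K, EssBoundedOn u.val C 0 1 := by
  obtain ⟨C, hC⟩ := exists_essBoundedOn_of_pairing_bounded (fun i : K => i.1) fun v => by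
    let := weakStarTopology E
    have hc : Continuous (pairing v : Control E → ℝ) :=
      continuous_iInf_dom (i := v) continuous_induced_dom
    obtain ⟨C, hC⟩ := hK.exists_bound_of_continuousOn hc.continuousOn
    exact ⟨C, fun i => hC i.1 i.2⟩
  exact ⟨C, fun u hu => hC ⟨u, hu⟩⟩

theorem WeakStarConverges.exists_essBoundedOn [CompleteSpace E] {u : ℕ → Control E}
    {w : Control E} (h : WeakStarConverges u w) :
    ∃ C, ∀ n, EssBoundedOn (u n).val C 0 1 :=
  exists_essBoundedOn_of_pairing_bounded u fun v => by
    obtain ⟨C, hC⟩ := (h v).norm.bddAbove_range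
    exact ⟨C, fun i => hC ⟨i, rfl⟩⟩

theorem WeakStarConverges.tendsto {u : ℕ → Control E} {w : Control E}
    (h : WeakStarConverges u w) : Tendsto u atTop (@nhds _ (weakStarTopology E) w) := by
  rw [nhds_iInf, tendsto_iInf]
  intro v
  rw [nhds_induced, tendsto_comap_iff]
  exact h v

/-- The primitive at a given time is weak* continuous. -/
theorem tendsto_integral [FiniteDimensional ℝ E] (u : Control E) {t : ℝ} (ht : t ∈ Icc (0 : ℝ) 1) :
    Tendsto (fun w : Control E => ∫ r in (0 : ℝ)..t, w.val r) (@nhds _ (weakStarTopology E) u)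
      (𝓝 (∫ r in (0 : ℝ)..t, u.val r)) := by
  have : CompleteSpace E := FiniteDimensional.complete ℝ E
  set e := (Module.finBasis ℝ E).equivFunL
  have key : Tendsto (fun w : Control E => e (∫ r in (0 : ℝ)..t, w.val r))
      (@nhds _ (weakStarTopology E) u) (𝓝 (e (∫ r in (0 : ℝ)..t, u.val r))) := by
    rw [tendsto_pi_nhds]
    intro i
    let φ : E →L[ℝ] ℝ := (ContinuousLinearMap.proj (R := ℝ) (φ := fun _ => ℝ) i).comp e.toContinuousLinearMap
    have hφ : ∀ w : Control E, e (∫ r in (0 : ℝ)..t, w.val r) i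
        = pairing (indicatorConstLp 1 (measurableSet_Ioc : MeasurableSet (Ioc 0 t))
          (measure_ne_top (volume.restrict (Icc (0 : ℝ) 1)) _) φ) w := fun w =>
      (pairing_indicatorConstLp w φ le_rfl ht.1 ht.2).symm
    simp only [hφ]
    let := weakStarTopology E
    have hc : Continuous (pairing (indicatorConstLp 1 (measurableSet_Ioc : MeasurableSet (Ioc 0 t))
          (measure_ne_top (volume.restrict (Icc (0 : ℝ) 1)) _) φ) : Control E → ℝ) :=
      continuous_iInf_dom (i := _) continuous_induced_dom
    exact hc.tendsto u
  simpa [Function.comp_def] using (e.symm.continuous.tendsto _).comp key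

/-- Among controls with a common bound, weak* neighbourhoods control all the integrals over
intervals uniformly. -/
theorem eventually_norm_integral_sub_le [FiniteDimensional ℝ E] {u : Control E} {C δ : ℝ}
    (hu : EssBoundedOn u.val C 0 1) (hδ : 0 < δ) :
    ∀ᶠ w in @nhds _ (weakStarTopology E) u, EssBoundedOn w.val C 0 1 →
      ∀ s ∈ Icc (0 : ℝ) 1, ∀ t ∈ Icc (0 : ℝ) 1, ‖∫ r in s..t, (w.val r - u.val r)‖ ≤ δ := by
  let := weakStarTopology E
  have h0 : (0 : ℝ) ∈ Icc (0 : ℝ) 1 := ⟨le_rfl, zero_le_one⟩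
  -- Primitives of controls bounded by C are equi-Lipschitz, so pointwise closeness becomes uniform
  -- by compactness of [0,1]. Membership in [0,1] is repeated inside the predicate because the
  -- compactness argument also evaluates it at nearby times outside the interval. The bound δ/2
  -- allows for a difference of two primitives.
  have key : ∀ᶠ w in 𝓝 u, ∀ t ∈ Icc (0 : ℝ) 1, t ∈ Icc (0 : ℝ) 1 → EssBoundedOn w.val C 0 1 →
      ‖∫ r in (0 : ℝ)..t, (w.val r - u.val r)‖ ≤ δ / 2 := by
    refine isCompact_Icc.eventually_forall_of_forall_eventually fun t ht => ?_
    have h1 : ∀ᶠ w in 𝓝 u, ‖(∫ r in (0 : ℝ)..t, w.val r) - ∫ r in (0 : ℝ)..t, u.val r‖ < δ / 4 := by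
      have := (u.tendsto_integral ht).sub_const (∫ r in (0 : ℝ)..t, u.val r)
      rw [sub_self] at this
      simpa using this.norm.eventually_lt_const (by simpa using (by positivity : 0 < δ / 4))
    have h2 : ∀ᶠ s in 𝓝 t, (C + C) * |s - t| < δ / 4 := by
      have : Tendsto (fun s => (C + C) * |s - t|) (𝓝 t) (𝓝 ((C + C) * |t - t|)) :=
        (by fun_prop : Continuous fun s => (C + C) * |s - t|).tendsto t
      rw [sub_self, abs_zero, mul_zero] at this
      exact this.eventually_lt_const (by positivity)
    rw [nhds_prod_eq]
    filter_upwards [h1.prod_mk h2] with ⟨w, s⟩ ⟨hw, hs⟩ hsI hwC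
    have hd := hwC.sub hu
    have e : ∫ r in (0 : ℝ)..s, (w.val r - u.val r) = (∫ r in (0 : ℝ)..t, (w.val r - u.val r))
        + ∫ r in t..s, (w.val r - u.val r) :=
      (intervalIntegral.integral_add_adjacent_intervals (hd.intervalIntegrable h0 ht)
        (hd.intervalIntegrable ht hsI)).symm
    have h3 := hd.norm_integral_le ht hsI
    simp only at hw hs
    rw [← intervalIntegral.integral_sub (hwC.intervalIntegrable h0 ht)
      (hu.intervalIntegrable h0 ht)] at hw
    rw [e]
    linarith [norm_add_le (∫ r in (0 : ℝ)..t, (w.val r - u.val r))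
      (∫ r in t..s, (w.val r - u.val r))]
  filter_upwards [key] with w hw hwC s hs t ht
  have hd := hwC.sub hu
  rw [← intervalIntegral.integral_interval_sub_left (hd.intervalIntegrable h0 ht)
    (hd.intervalIntegrable h0 hs)]
  linarith [norm_sub_le (∫ r in (0 : ℝ)..t, (w.val r - u.val r))
    (∫ r in (0 : ℝ)..s, (w.val r - u.val r)), hw s hs hs hwC, hw t ht ht hwC]

/-- A filter of neighbourhoods of a control that is coarser than the sequential weak* one, and
still has the trace of the weak* topology on bounded sets. -/
noncomputable def boundedWeakStarNhds (u : Control E) : Filter (Control E) :=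
  𝓝 u ⊔ ⨆ C : ℝ, @nhds _ (weakStarTopology E) u ⊓ 𝓟 {w | EssBoundedOn w.val C 0 1}

end Control

/-! ### Neighbourhoods in sequential topologies built from chains. -/

/-- The points reached from `a` in at most `n` steps, where the step number `k` goes from a point
to one of its `R k`-successors. -/
def chainReach {X : Type*} (R : ℕ → X → X → Prop) (a : X) : ℕ → Set X
  | 0 => {a}
  | n + 1 => chainReach R a n ∪ {y | ∃ x ∈ chainReach R a n, R n x y}

section ChainReach

variable {X : Type*} {R : ℕ → X → X → Prop} {a : X}

theorem chainReach_mono : Monotone (chainReach R a) :=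
  monotone_nat_of_le_succ fun _ => subset_union_left

/-- The threshold N may depend on the convergent sequence: a chain that has reached b early can wait
until step N before moving to the terms of the sequence. This yields open sets although no single
tolerance serves all sequences. -/
theorem iUnion_chainReach_mem_nhds {conv : (ℕ → X) → X → Prop}
    (h : ∀ x b, conv x b → ∃ N, ∀ n ≥ N, ∀ᶠ k in atTop, R n b (x k)) :
    ⋃ n, chainReach R a n ∈ @nhds X (seqTopology conv) a := by
  let := seqTopology conv
  refine IsOpen.mem_nhds (fun x b hx hb => ?_) (mem_iUnion.2 ⟨0, rfl⟩)
  obtain ⟨n, hn⟩ := mem_iUnion.1 hb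
  obtain ⟨N, hN⟩ := h x b hx
  filter_upwards [hN (max n N) (le_max_right _ _)] with k hk
  exact mem_iUnion.2 ⟨max n N + 1, Or.inr ⟨b, chainReach_mono (le_max_left _ _) hn, hk⟩⟩

/-- Reflexivity turns waiting into a genuine step, so that two chains of different lengths can be
run in parallel. -/
theorem exists_mem_chainReach_of_succ {n : ℕ} (hR : ∀ x ∈ chainReach R a n, R n x x) {y : X}
    (hy : y ∈ chainReach R a (n + 1)) : ∃ x ∈ chainReach R a n, R n x y := by
  rcases hy with hy | hy
  · exact ⟨y, hy, hR y hy⟩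
  · exact hy

end ChainReach

/-! ### Sections in charts: bounds and convergence on compact sets. -/

section SectionInChart

variable {m : ℕ} {E M : Type*} [NormedAddCommGroup E] [NormedSpace ℝ E]
  [TopologicalSpace M] [ChartedSpace (EuclideanSpace ℝ (Fin m)) M]
  {e e' : OpenPartialHomeomorph M (EuclideanSpace ℝ (Fin m))}

theorem sectionInChart_apply (f : (p : M) → E →L[ℝ] TangentSpace (𝓡 m) p) {p : M}
    (hp : p ∈ e.source) :
    sectionInChart e f (e p) = (mfderiv (𝓡 m) (𝓡 m) e p).comp (f p) := by
  let F : M → (E →L[ℝ] EuclideanSpace ℝ (Fin m)) := fun q =>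
    (mfderiv (𝓡 m) (𝓡 m) e q).comp (f q)
  exact congrArg F (e.left_inv hp)

theorem contDiffAt_coordChange (he : e ∈ IsManifold.maximalAtlas (𝓡 m) ∞ M)
    (he' : e' ∈ IsManifold.maximalAtlas (𝓡 m) ∞ M) {x : EuclideanSpace ℝ (Fin m)}
    (hx : x ∈ e.target) (hx' : e.symm x ∈ e'.source) :
    ContDiffAt ℝ ∞ (e' ∘ e.symm) x :=
  ((contMDiffAt_of_mem_maximalAtlas he' hx').comp x
    (contMDiffAt_symm_of_mem_maximalAtlas he hx)).contDiffAt

theorem sectionInChart_eq_comp (he : e ∈ IsManifold.maximalAtlas (𝓡 m) ∞ M)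
    (he' : e' ∈ IsManifold.maximalAtlas (𝓡 m) ∞ M)
    (f : (p : M) → E →L[ℝ] TangentSpace (𝓡 m) p) {x : EuclideanSpace ℝ (Fin m)}
    (hx : x ∈ e.target) (hx' : e.symm x ∈ e'.source) :
    sectionInChart e f x = (fderiv ℝ (e ∘ e'.symm) (e' (e.symm x))).comp
      (sectionInChart e' f (e' (e.symm x))) := by
  have hp : e.symm x ∈ e.source := e.map_target hx
  have hcd : ContDiffAt ℝ ∞ (e ∘ e'.symm) (e' (e.symm x)) :=
    contDiffAt_coordChange he' he (e'.map_source hx') (by rwa [e'.left_inv hx'])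
  have hd : mfderiv (𝓡 m) (𝓡 m) e (e.symm x)
      = (mfderiv (𝓡 m) (𝓡 m) (e ∘ e'.symm) (e' (e.symm x))).comp
        (mfderiv (𝓡 m) (𝓡 m) e' (e.symm x)) := by
    rw [← mfderiv_comp (e.symm x) (hcd.differentiableAt (by simp)).mdifferentiableAt
      ((contMDiffAt_of_mem_maximalAtlas he' hx').mdifferentiableAt (by simp))]
    refine Filter.EventuallyEq.mfderiv_eq ?_
    filter_upwards [e'.open_source.mem_nhds hx'] with q hq
    simp [e'.left_inv hq]
  rw [sectionInChart_apply f hx', sectionInChart, hd, mfderiv_eq_fderiv]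
  rfl

theorem norm_sectionInChart_sub_le (he : e ∈ IsManifold.maximalAtlas (𝓡 m) ∞ M)
    (he' : e' ∈ IsManifold.maximalAtlas (𝓡 m) ∞ M)
    (f g : (p : M) → E →L[ℝ] TangentSpace (𝓡 m) p) {x : EuclideanSpace ℝ (Fin m)}
    (hx : x ∈ e.target) (hx' : e.symm x ∈ e'.source) :
    ‖sectionInChart e f x - sectionInChart e g x‖ ≤
      ‖fderiv ℝ (e ∘ e'.symm) (e' (e.symm x))‖ *
        ‖sectionInChart e' f (e' (e.symm x)) - sectionInChart e' g (e' (e.symm x))‖ := by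
  rw [sectionInChart_eq_comp he he' f hx hx', sectionInChart_eq_comp he he' g hx hx',
    ← ContinuousLinearMap.comp_sub]
  exact ContinuousLinearMap.opNorm_comp_le _ _

theorem exists_coordChange_bounds (he : e ∈ IsManifold.maximalAtlas (𝓡 m) ∞ M)
    (he' : e' ∈ IsManifold.maximalAtlas (𝓡 m) ∞ M) {x : EuclideanSpace ℝ (Fin m)}
    (hx : x ∈ e.target) (hx' : e.symm x ∈ e'.source) :
    ∃ C : ℝ, 0 ≤ C ∧ ∃ ρ > 0, ∀ y ∈ Metric.ball x ρ, y ∈ e.target ∧ e.symm y ∈ e'.source ∧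
      ‖fderiv ℝ (e ∘ e'.symm) (e' (e.symm y))‖ ≤ C ∧ ∀ z ∈ Metric.ball x ρ,
      ‖e' (e.symm y) - e' (e.symm z)‖ ≤ C * ‖y - z‖ ∧
      ‖fderiv ℝ (e ∘ e'.symm) (e' (e.symm y)) - fderiv ℝ (e ∘ e'.symm) (e' (e.symm z))‖
        ≤ C * ‖y - z‖ := by
  have h1 : ContDiffAt ℝ ∞ (e' ∘ e.symm) x := contDiffAt_coordChange he he' hx hx'
  have h2 : ContDiffAt ℝ ∞ (e ∘ e'.symm) ((e' ∘ e.symm) x) :=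
    contDiffAt_coordChange he' he (e'.map_source hx') (by simpa [e'.left_inv hx'] using e.map_target hx)
  have h3 : ContDiffAt ℝ 1 (fderiv ℝ (e ∘ e'.symm) ∘ (e' ∘ e.symm)) x :=
    (h2.fderiv_right (m := 1) (by norm_cast)).comp x (h1.of_le (by norm_cast))
  obtain ⟨K1, t1, ht1, hK1⟩ := (h1.of_le (n := ∞) (m := 1)
    (by norm_cast)).exists_lipschitzOnWith
  obtain ⟨K2, t2, ht2, hK2⟩ := h3.exists_lipschitzOnWith
  set A := fderiv ℝ (e ∘ e'.symm) ∘ (e' ∘ e.symm) with hA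
  have h4 : ∀ᶠ y in 𝓝 x, ‖A y‖ < ‖A x‖ + 1 :=
    h3.continuousAt.norm.eventually_lt_const (lt_add_one _)
  have h5 : ∀ᶠ y in 𝓝 x, e.symm y ∈ e'.source :=
    (e.continuousAt_symm hx).eventually (e'.open_source.mem_nhds hx')
  obtain ⟨ρ, hρ, hsub⟩ := Metric.eventually_nhds_iff_ball.1
    ((((e.open_target.eventually_mem hx).and h5).and h4).and
      ((eventually_mem_set.2 ht1).and (eventually_mem_set.2 ht2)))
  refine ⟨max (max K1 K2) (‖A x‖ + 1), by positivity, ρ, hρ, fun y hy => ?_⟩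
  obtain ⟨⟨⟨y1, y2⟩, y3⟩, y4, y5⟩ := hsub y hy
  refine ⟨y1, y2, y3.le.trans (le_max_right _ _), fun z hz => ?_⟩
  obtain ⟨-, z4, z5⟩ := hsub z hz
  constructor
  · have := hK1.dist_le_mul y y4 z z4
    rw [dist_eq_norm, dist_eq_norm] at this
    refine this.trans ?_
    gcongr
    exact (le_max_left _ _).trans (le_max_left _ _)
  · have := hK2.dist_le_mul y y5 z z5
    rw [dist_eq_norm, dist_eq_norm] at this
    refine this.trans ?_
    gcongr
    exact (le_max_right _ _).trans (le_max_left _ _)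

/-- A uniformly locally Lipschitz family that is bounded at a point is bounded and uniformly
Lipschitz near this point, in any chart. -/
theorem UniformlyLocallyLipschitz.exists_ball_bounds
    {S : Set ((p : M) → E →L[ℝ] TangentSpace (𝓡 m) p)} (hS : UniformlyLocallyLipschitz S)
    (he : e ∈ IsManifold.maximalAtlas (𝓡 m) ∞ M) {x : EuclideanSpace ℝ (Fin m)}
    (hx : x ∈ e.target) (hb : ∃ B, ∀ f ∈ S, ‖sectionInChart e f x‖ ≤ B) :
    ∃ ρ > 0, ∃ D : ℝ, 0 ≤ D ∧ ∀ f ∈ S, ∀ y ∈ Metric.ball x ρ, ‖sectionInChart e f y‖ ≤ D ∧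
      ∀ z ∈ Metric.ball x ρ, ‖sectionInChart e f y - sectionInChart e f z‖ ≤ D * ‖y - z‖ := by
  obtain ⟨B, hB⟩ := hb
  obtain ⟨e', he', hxe', L, hL⟩ := hS (e.symm x)
  obtain ⟨C, hC, ρ, hρ, hbd⟩ := exists_coordChange_bounds he he' hx hxe'
  set τ : EuclideanSpace ℝ (Fin m) → EuclideanSpace ℝ (Fin m) := fun y => e' (e.symm y) with hτ
  set A := fun y => fderiv ℝ (e ∘ e'.symm) (τ y) with hA
  set Q := ‖fderiv ℝ (e' ∘ e.symm) x‖ with hQ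
  set B' := max B 0
  have hB' : 0 ≤ B' := le_max_right _ _
  set D' := Q * B' + L * (C * (2 * ρ)) with hD'
  have hD'0 : 0 ≤ D' := by positivity
  have hxball : x ∈ Metric.ball x ρ := Metric.mem_ball_self hρ
  have hlip : ∀ f ∈ S, ∀ y ∈ Metric.ball x ρ, ∀ z ∈ Metric.ball x ρ,
      ‖sectionInChart e' f (τ y) - sectionInChart e' f (τ z)‖ ≤ L * (C * ‖y - z‖) := by
    intro f hf y hy z hz
    have := (hL f hf).dist_le_mul (τ y) (e'.map_source (hbd y hy).2.1) (τ z)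
      (e'.map_source (hbd z hz).2.1)
    rw [dist_eq_norm, dist_eq_norm] at this
    exact this.trans (mul_le_mul_of_nonneg_left ((hbd y hy).2.2.2 z hz).1 L.2)
  -- The bound at x is known in the chart e. The derivative of the coordinate change carries it to
  -- e', where the common Lipschitz constant spreads it over the ball.
  have hbound : ∀ f ∈ S, ∀ y ∈ Metric.ball x ρ, ‖sectionInChart e' f (τ y)‖ ≤ D' := by
    intro f hf y hy
    have h1 : ‖sectionInChart e' f (τ x)‖ ≤ Q * B' := by
      have := sectionInChart_eq_comp he' he f (e'.map_source hxe')
        (by rw [e'.left_inv hxe']; exact e.map_target hx)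
      rw [e'.left_inv hxe', e.right_inv hx] at this
      rw [hτ]
      simp only
      rw [this]
      refine (ContinuousLinearMap.opNorm_comp_le _ _).trans ?_
      gcongr
      exact (hB f hf).trans (le_max_left _ _)
    have h2 := hlip f hf y hy x hxball
    have h3 : ‖y - x‖ ≤ 2 * ρ := by
      rw [← dist_eq_norm]
      linarith [Metric.mem_ball.1 hy]
    have h4 : (L : ℝ) * (C * ‖y - x‖) ≤ L * (C * (2 * ρ)) := by gcongr
    have h5 := norm_le_norm_add_norm_sub' (sectionInChart e' f (τ y)) (sectionInChart e' f (τ x))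
    linarith
  have heq : ∀ f : (p : M) → E →L[ℝ] TangentSpace (𝓡 m) p, ∀ y ∈ Metric.ball x ρ,
      sectionInChart e f y = (A y).comp (sectionInChart e' f (τ y)) := fun f y hy =>
    sectionInChart_eq_comp he he' f (hbd y hy).1 (hbd y hy).2.1
  refine ⟨ρ, hρ, max (C * D') (C * D' + C * (L * C)), by positivity, fun f hf y hy => ⟨?_, ?_⟩⟩
  · rw [heq f y hy]
    refine (ContinuousLinearMap.opNorm_comp_le _ _).trans (le_trans ?_ (le_max_left _ _))
    exact mul_le_mul (hbd y hy).2.2.1 (hbound f hf y hy) (norm_nonneg _) hC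
  · intro z hz
    rw [heq f y hy, heq f z hz]
    have e1 : (A y).comp (sectionInChart e' f (τ y)) - (A z).comp (sectionInChart e' f (τ z))
        = (A y - A z).comp (sectionInChart e' f (τ y))
          + (A z).comp (sectionInChart e' f (τ y) - sectionInChart e' f (τ z)) := by
      ext v
      simp
    rw [e1]
    have n1 : ‖(A y - A z).comp (sectionInChart e' f (τ y))‖ ≤ C * ‖y - z‖ * D' :=
      (ContinuousLinearMap.opNorm_comp_le _ _).trans
        (mul_le_mul ((hbd y hy).2.2.2 z hz).2 (hbound f hf y hy) (norm_nonneg _) (by positivity))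
    have n2 : ‖(A z).comp (sectionInChart e' f (τ y) - sectionInChart e' f (τ z))‖
        ≤ C * (L * (C * ‖y - z‖)) :=
      (ContinuousLinearMap.opNorm_comp_le _ _).trans
        (mul_le_mul (hbd z hz).2.2.1 (hlip f hf y hy z hz) (norm_nonneg _) hC)
    calc _ ≤ _ := norm_add_le _ _
      _ ≤ (C * D' + C * (L * C)) * ‖y - z‖ := by linarith
      _ ≤ _ := by gcongr; exact le_max_right _ _

/-- `g` is bounded by `D` and `D`-Lipschitz on `K`. -/
def BoundedLipschitzOn {X Y : Type*} [NormedAddCommGroup X] [NormedAddCommGroup Y]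
    (g : X → Y) (K : Set X) (D : ℝ) : Prop :=
  ∀ y ∈ K, ‖g y‖ ≤ D ∧ ∀ z ∈ K, ‖g y - g z‖ ≤ D * ‖y - z‖

theorem BoundedLipschitzOn.weaken {X Y : Type*} [NormedAddCommGroup X] [NormedAddCommGroup Y]
    {g : X → Y} {K : Set X} {D D' : ℝ} (h : BoundedLipschitzOn g K D) (hD : D ≤ D') :
    BoundedLipschitzOn g K D' :=
  fun y hy => ⟨(h y hy).1.trans hD, fun z hz => ((h y hy).2 z hz).trans (by gcongr)⟩

/-- Compactness gives one bound D and one Lipschitz estimate for points closer than some δ. Points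
further apart are handled by the bound, with constant 2D/δ, so K need not be convex. -/
theorem UniformlyLocallyLipschitz.exists_boundedLipschitzOn
    {S : Set ((p : M) → E →L[ℝ] TangentSpace (𝓡 m) p)} (hS : UniformlyLocallyLipschitz S)
    (he : e ∈ IsManifold.maximalAtlas (𝓡 m) ∞ M) {K : Set (EuclideanSpace ℝ (Fin m))}
    (hK : IsCompact K) (hKe : K ⊆ e.target)
    (hb : ∀ x ∈ K, ∃ B, ∀ f ∈ S, ‖sectionInChart e f x‖ ≤ B) :
    ∃ D : ℝ, 0 ≤ D ∧ ∀ f ∈ S, BoundedLipschitzOn (sectionInChart e f) K D := by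
  have key : ∃ D : ℝ, 0 ≤ D ∧ ∃ δ > 0, ∀ f ∈ S, ∀ y ∈ K, ‖sectionInChart e f y‖ ≤ D ∧
      ∀ z ∈ K, ‖y - z‖ < δ → ‖sectionInChart e f y - sectionInChart e f z‖ ≤ D * ‖y - z‖ := by
    refine hK.induction_on (p := fun s => ∃ D : ℝ, 0 ≤ D ∧ ∃ δ > 0, ∀ f ∈ S, ∀ y ∈ s,
      ‖sectionInChart e f y‖ ≤ D ∧ ∀ z ∈ K, ‖y - z‖ < δ →
        ‖sectionInChart e f y - sectionInChart e f z‖ ≤ D * ‖y - z‖)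
      ⟨0, le_rfl, 1, one_pos, by simp⟩ ?_ ?_ ?_
    · rintro s t hst ⟨D, hD, δ, hδ, h⟩
      exact ⟨D, hD, δ, hδ, fun f hf y hy => h f hf y (hst hy)⟩
    · rintro s t ⟨D, hD, δ, hδ, h⟩ ⟨D', hD', δ', hδ', h'⟩
      refine ⟨max D D', le_max_of_le_left hD, min δ δ', lt_min hδ hδ', fun f hf y hy => ?_⟩
      rcases hy with hy | hy
      · refine ⟨(h f hf y hy).1.trans (le_max_left _ _), fun z hz hyz => ?_⟩
        refine ((h f hf y hy).2 z hz (hyz.trans_le (min_le_left _ _))).trans ?_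
        gcongr
        exact le_max_left _ _
      · refine ⟨(h' f hf y hy).1.trans (le_max_right _ _), fun z hz hyz => ?_⟩
        refine ((h' f hf y hy).2 z hz (hyz.trans_le (min_le_right _ _))).trans ?_
        gcongr
        exact le_max_right _ _
    · intro x hx
      obtain ⟨ρ, hρ, D, hD, h⟩ := hS.exists_ball_bounds he (hKe hx) (hb x hx)
      -- Halving the radius keeps every z at distance less than ρ/2 from y in the ball of radius ρ,
      -- where the local estimate holds.
      refine ⟨Metric.ball x (ρ / 2), mem_nhdsWithin_of_mem_nhds (Metric.ball_mem_nhds x (by positivity)),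
        D, hD, ρ / 2, by positivity, fun f hf y hy => ?_⟩
      have hy' : y ∈ Metric.ball x ρ := Metric.ball_subset_ball (by linarith) hy
      refine ⟨(h f hf y hy').1, fun z _ hyz => (h f hf y hy').2 z ?_⟩
      rw [← dist_eq_norm] at hyz
      rw [Metric.mem_ball] at hy ⊢
      rw [dist_comm] at hyz
      linarith [dist_triangle z y x]
  obtain ⟨D, hD, δ, hδ, h⟩ := key
  refine ⟨max D (2 * D / δ), le_max_of_le_left hD, fun f hf y hy =>
    ⟨(h f hf y hy).1.trans (le_max_left _ _), fun z hz => ?_⟩⟩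
  rcases lt_or_ge ‖y - z‖ δ with hyz | hyz
  · refine ((h f hf y hy).2 z hz hyz).trans ?_
    gcongr
    exact le_max_left _ _
  · calc _ ≤ ‖sectionInChart e f y‖ + ‖sectionInChart e f z‖ := norm_sub_le _ _
      _ ≤ 2 * D := by linarith [(h f hf y hy).1, (h f hf z hz).1]
      _ = 2 * D / δ * δ := by field_simp
      _ ≤ _ := by
        gcongr
        exact le_max_right _ _

theorem LipSection.exists_boundedLipschitzOn (f : LipSection m E M)
    (he : e ∈ IsManifold.maximalAtlas (𝓡 m) ∞ M) {K : Set (EuclideanSpace ℝ (Fin m))}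
    (hK : IsCompact K) (hKe : K ⊆ e.target) :
    ∃ D : ℝ, 0 ≤ D ∧ BoundedLipschitzOn (sectionInChart e f.1) K D := by
  obtain ⟨D, hD, h⟩ := f.2.exists_boundedLipschitzOn he hK hKe fun x _ =>
    ⟨‖sectionInChart e f.1 x‖, by simp⟩
  exact ⟨D, hD, h f.1 rfl⟩

/-- The definition only provides some chart at each point; the coordinate change multiplies
differences by a locally bounded linear map, so uniform convergence passes to any chart. -/
theorem LipSection.Converges.tendstoUniformlyOn {f : ℕ → LipSection m E M} {g : LipSection m E M}
    (h : Converges f g) (he : e ∈ IsManifold.maximalAtlas (𝓡 m) ∞ M)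
    {K : Set (EuclideanSpace ℝ (Fin m))} (hK : IsCompact K) (hKe : K ⊆ e.target) :
    TendstoUniformlyOn (fun n => sectionInChart e (f n).1) (sectionInChart e g.1) atTop K := by
  rw [← tendstoLocallyUniformlyOn_iff_tendstoUniformlyOn_of_compact hK,
    Metric.tendstoLocallyUniformlyOn_iff]
  intro ε hε x hx
  obtain ⟨e', he', hxe', hconv⟩ := h.2 (e.symm x)
  obtain ⟨C, hC, ρ, hρ, hbd⟩ := exists_coordChange_bounds he he' (hKe hx) hxe'
  obtain ⟨r, hr, hball⟩ := Metric.nhds_basis_closedBall.mem_iff.1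
    (e'.open_target.mem_nhds (e'.map_source hxe'))
  have hτ : ContinuousAt (e' ∘ e.symm) x :=
    (contDiffAt_coordChange he he' (hKe hx) hxe').continuousAt
  have hn : (e' ∘ e.symm) ⁻¹' Metric.closedBall (e' (e.symm x)) r ∩ Metric.ball x ρ ∈ 𝓝 x :=
    inter_mem (hτ.preimage_mem_nhds (Metric.closedBall_mem_nhds _ hr)) (Metric.ball_mem_nhds x hρ)
  refine ⟨_, mem_nhdsWithin_of_mem_nhds hn, ?_⟩
  have := Metric.tendstoUniformlyOn_iff.1 (hconv _ hball (isCompact_closedBall _ _))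
    (ε / (C + 1)) (by positivity)
  filter_upwards [this] with n hn y hy
  have h1 := hn (e' (e.symm y)) hy.1
  rw [dist_eq_norm] at h1
  rw [dist_eq_norm]
  have h2 := (hbd y hy.2).2.2.1
  have h3 := norm_sectionInChart_sub_le he he' g.1 (f n).1 (hbd y hy.2).1 (hbd y hy.2).2.1
  have h4 := mul_le_mul h2 h1.le (norm_nonneg _) hC
  have h5 : 0 < ε / (C + 1) := by positivity
  have h6 : (C + 1) * (ε / (C + 1)) = ε := by field_simp
  have h7 := h3.trans h4
  linarith

theorem LipSection.Converges.exists_boundedLipschitzOn {f : ℕ → LipSection m E M}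
    {g : LipSection m E M} (h : Converges f g) (he : e ∈ IsManifold.maximalAtlas (𝓡 m) ∞ M)
    {K : Set (EuclideanSpace ℝ (Fin m))} (hK : IsCompact K) (hKe : K ⊆ e.target) :
    ∃ D : ℝ, 0 ≤ D ∧ ∀ n, BoundedLipschitzOn (sectionInChart e (f n).1) K D := by
  obtain ⟨D, hD, hS⟩ := h.1.exists_boundedLipschitzOn he hK hKe fun x hx => by
    obtain ⟨B, hB⟩ := ((h.tendstoUniformlyOn he hK hKe).tendsto_at hx).norm.bddAbove_range
    refine ⟨B, ?_⟩
    rintro _ ⟨n, rfl⟩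
    exact hB ⟨n, rfl⟩
  exact ⟨D, hD, fun n => hS _ ⟨n, rfl⟩⟩

end SectionInChart

/-! ### Solutions on the manifold: charts, gluing, uniqueness. -/

/-- A continuous function which is absolutely continuous with almost everywhere derivative `h u` is
a primitive of `h u`. -/
theorem AbsolutelyContinuousOnInterval.eq_add_integral {E X : Type*} [NormedAddCommGroup E]
    [NormedSpace ℝ E] [NormedAddCommGroup X] [NormedSpace ℝ X] [CompleteSpace X] {x : ℝ → X}
    {h : ℝ → E →L[ℝ] X} {u : ℝ → E} {a b C : ℝ} (hx : AbsolutelyContinuousOnInterval x a b)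
    (hu : EssBoundedOn u C a b) (hh : ContinuousOn h (Icc a b))
    (hd : ∀ᵐ t ∂(volume.restrict (Icc a b)), HasDerivAt x (h t (u t)) t) :
    ∀ t ∈ Icc a b, x t = x a + ∫ s in a..t, h s (u s) := by
  intro t ht
  have hab : a ≤ b := ht.1.trans ht.2
  have ha : a ∈ Icc a b := left_mem_Icc.2 hab
  have hb : b ∈ Icc a b := right_mem_Icc.2 hab
  obtain ⟨M, hM⟩ := isCompact_Icc.exists_bound_of_continuousOn hh
  have hi := hu.intervalIntegrable_apply hh ha hb
  have hlip : LipschitzOnWith (M * C).toNNReal (fun t => ∫ s in a..t, h s (u s)) (Icc a b) := by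
    refine LipschitzOnWith.of_dist_le_mul fun s hs t ht => ?_
    rw [dist_eq_norm, intervalIntegral.integral_interval_sub_left
      (hu.intervalIntegrable_apply hh ha hs) (hu.intervalIntegrable_apply hh ha ht), Real.dist_eq]
    refine (hu.norm_integral_apply_le ht hs fun r hr => hM r (uIcc_subset_Icc ht hs hr)).trans ?_
    gcongr
    exact Real.le_coe_toNNReal _
  rw [← uIcc_of_le hab] at hlip
  -- The difference from the primitive is absolutely continuous with zero derivative almost
  -- everywhere, hence constant.
  obtain ⟨c, hc⟩ := (hx.sub hlip.absolutelyContinuousOnInterval).const_of_ae_hasDerivAt_zero (by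
    rw [ae_restrict_iff' measurableSet_Icc] at hd
    filter_upwards [hd, hi.ae_hasDerivAt_integral] with s h1 h2 hs
    have h3 := h2 hs a left_mem_uIcc
    rw [uIcc_of_le hab] at hs
    simpa using (h1 hs).sub h3)
  rw [uIcc_of_le hab] at hc
  have h1 := hc t ht
  have h2 := hc a ha
  simp only [Pi.sub_apply, intervalIntegral.integral_same, sub_zero] at h1 h2
  rw [h2, ← h1]
  abel

section Solutions

variable {m : ℕ} {E M : Type*} [NormedAddCommGroup E] [NormedSpace ℝ E]
  [TopologicalSpace M] [ChartedSpace (EuclideanSpace ℝ (Fin m)) M]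
  {e e' : OpenPartialHomeomorph M (EuclideanSpace ℝ (Fin m))}
  {f : LipSection m E M} {u : Control E} {γ γ' : ℝ → M} {a b c d : ℝ}

theorem hasMFDerivAt_iff_hasDerivAt_chart (he : e ∈ IsManifold.maximalAtlas (𝓡 m) ∞ M)
    (f : (p : M) → E →L[ℝ] TangentSpace (𝓡 m) p) {t : ℝ} {v : E}
    (ht : γ t ∈ e.source) (hγ : ContinuousAt γ t) :
    HasMFDerivAt 𝓘(ℝ, ℝ) (𝓡 m) γ t ((1 : ℝ →L[ℝ] ℝ).smulRight (f (γ t) v)) ↔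
      HasDerivAt (fun s => e (γ s)) (sectionInChart e f (e (γ t)) v) t := by
  have hmd : MDifferentiableAt (𝓡 m) (𝓡 m) e (γ t) :=
    (contMDiffAt_of_mem_maximalAtlas he ht).mdifferentiableAt (by simp)
  constructor
  · intro h
    have h1 : HasMFDerivAt 𝓘(ℝ, ℝ) (𝓡 m) (fun s => e (γ s)) t
        ((1 : ℝ →L[ℝ] ℝ).smulRight (sectionInChart e f (e (γ t)) v)) := by
      refine (hmd.hasMFDerivAt.comp t h).congr_mfderiv ?_
      rw [sectionInChart_apply f ht]
      ext1
      change mfderiv (𝓡 m) (𝓡 m) e (γ t) ((1 : ℝ) • f (γ t) v)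
        = (1 : ℝ) • mfderiv (𝓡 m) (𝓡 m) e (γ t) (f (γ t) v)
      rw [one_smul, one_smul]
    have h2 : HasFDerivAt (fun s => e (γ s))
        ((1 : ℝ →L[ℝ] ℝ).smulRight (sectionInChart e f (e (γ t)) v)) t :=
      hasMFDerivAt_iff_hasFDerivAt.1 h1
    simpa using h2.hasDerivAt
  · intro h
    have hmd' : MDifferentiableAt (𝓡 m) (𝓡 m) e.symm (e (γ t)) :=
      (contMDiffAt_symm_of_mem_maximalAtlas he (e.map_source ht)).mdifferentiableAt (by simp)
    have h1 := hmd'.hasMFDerivAt.comp t h.hasFDerivAt.hasMFDerivAt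
    have heq : γ =ᶠ[𝓝 t] e.symm ∘ fun s => e (γ s) := by
      filter_upwards [hγ.eventually (e.open_source.mem_nhds ht)] with s hs
      simp [e.left_inv hs]
    refine (h1.congr_of_eventuallyEq heq).congr_mfderiv ?_
    have hid : (mfderiv (𝓡 m) (𝓡 m) e.symm (e (γ t))).comp (mfderiv (𝓡 m) (𝓡 m) e (γ t))
        = ContinuousLinearMap.id ℝ (TangentSpace (𝓡 m) (γ t)) := by
      rw [← mfderiv_comp (γ t) hmd' hmd, ← mfderiv_id (I := 𝓡 m) (x := γ t)]
      refine Filter.EventuallyEq.mfderiv_eq ?_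
      filter_upwards [e.open_source.mem_nhds ht] with q hq
      simp [e.left_inv hq]
    rw [sectionInChart_apply f ht]
    ext1
    change mfderiv (𝓡 m) (𝓡 m) e.symm (e (γ t))
        ((1 : ℝ) • mfderiv (𝓡 m) (𝓡 m) e (γ t) (f (γ t) v)) = (1 : ℝ) • f (γ t) v
    rw [one_smul, one_smul]
    exact congrArg (fun A => A (f (γ t) v)) hid

end Solutions

/-- The representation of a section in a chart, extended from a closed ball to the whole space by
composition with the radial retraction. -/
noncomputable def ballExtension {m : ℕ} {E M : Type*} [NormedAddCommGroup E] [NormedSpace ℝ E]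
    [TopologicalSpace M] [ChartedSpace (EuclideanSpace ℝ (Fin m)) M]
    (e : OpenPartialHomeomorph M (EuclideanSpace ℝ (Fin m)))
    (f : (p : M) → E →L[ℝ] TangentSpace (𝓡 m) p) (c : EuclideanSpace ℝ (Fin m)) (r : ℝ)
    (x : EuclideanSpace ℝ (Fin m)) : E →L[ℝ] EuclideanSpace ℝ (Fin m) :=
  sectionInChart e f (radialRetraction c r x)

/-- `γ` is a locally Lipschitz solution on `[a, b]` of `γ' = f(γ) u`. -/
structure IsSolutionOn {m : ℕ} {E M : Type*} [NormedAddCommGroup E] [NormedSpace ℝ E]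
    [TopologicalSpace M] [ChartedSpace (EuclideanSpace ℝ (Fin m)) M]
    (f : LipSection m E M) (u : Control E) (γ : ℝ → M) (a b : ℝ) : Prop where
  continuousOn : ContinuousOn γ (Icc a b)
  locallyLipschitz : ∀ t ∈ Icc a b, ∀ e ∈ IsManifold.maximalAtlas (𝓡 m) ∞ M, γ t ∈ e.source →
    ∃ L, ∃ s ∈ 𝓝[Icc a b] t, LipschitzOnWith L (fun t => e (γ t)) s
  deriv_ae : ∀ᵐ t ∂(volume.restrict (Icc a b)),
    HasMFDerivAt 𝓘(ℝ, ℝ) (𝓡 m) γ t ((1 : ℝ →L[ℝ] ℝ).smulRight (f.1 (γ t) (u.val t)))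

/-- Continuous curves stay for a short time in chart balls. -/
theorem exists_interval_mapsTo_closedBall {X M : Type*} [PseudoMetricSpace X]
    [TopologicalSpace M] {e : OpenPartialHomeomorph M X} {γ : ℝ → M} {a b r t : ℝ}
    (hγ : ContinuousOn γ (Icc a b))
    (ht : t ∈ Icc a b) (hte : γ t ∈ e.source) (hr : 0 < r) :
    ∃ ε > 0, ∀ s ∈ Icc a b, |s - t| ≤ ε →
      γ s ∈ e.source ∧ e (γ s) ∈ Metric.closedBall (e (γ t)) r := by
  have h1 : ∀ᶠ p in 𝓝 (γ t), p ∈ e.source ∧ e p ∈ Metric.closedBall (e (γ t)) r :=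
    (e.open_source.eventually_mem hte).and
      ((e.continuousAt hte).eventually (Metric.closedBall_mem_nhds _ hr))
  have h2 := (hγ t ht).eventually h1
  obtain ⟨ε, hε, h⟩ := Metric.mem_nhdsWithin_iff.1 h2
  refine ⟨ε / 2, by positivity, fun s hs hst => h ⟨?_, hs⟩⟩
  rw [Metric.mem_ball, Real.dist_eq]
  linarith

section Solutions

variable {m : ℕ} {E M : Type*} [NormedAddCommGroup E] [NormedSpace ℝ E]
  [TopologicalSpace M] [ChartedSpace (EuclideanSpace ℝ (Fin m)) M]
  {e e' : OpenPartialHomeomorph M (EuclideanSpace ℝ (Fin m))}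
  {f : LipSection m E M} {u : Control E} {γ γ' : ℝ → M} {a b : ℝ}
  {c : EuclideanSpace ℝ (Fin m)} {r : ℝ}

theorem ballExtension_bounds {f : (p : M) → E →L[ℝ] TangentSpace (𝓡 m) p} {D : ℝ} (hr : 0 < r)
    (hD : 0 ≤ D)
    (h : BoundedLipschitzOn (sectionInChart e f) (Metric.closedBall c r) D) :
    (∀ x, ‖ballExtension e f c r x‖ ≤ D) ∧
      ∀ x y, ‖ballExtension e f c r x - ballExtension e f c r y‖ ≤ 2 * D * ‖x - y‖ := by
  refine ⟨fun x => (h _ (radialRetraction_mem hr x)).1, fun x y => ?_⟩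
  refine ((h _ (radialRetraction_mem hr x)).2 _ (radialRetraction_mem hr y)).trans ?_
  have := mul_le_mul_of_nonneg_left (norm_radialRetraction_sub_le (c := c) hr x y) hD
  linarith

theorem ballExtension_of_mem (f : (p : M) → E →L[ℝ] TangentSpace (𝓡 m) p) (hr : 0 < r)
    {x : EuclideanSpace ℝ (Fin m)} (hx : x ∈ Metric.closedBall c r) :
    ballExtension e f c r x = sectionInChart e f x := by
  rw [ballExtension, radialRetraction_of_mem hr hx]

theorem isIntegralSolution_chart (he : e ∈ IsManifold.maximalAtlas (𝓡 m) ∞ M) (hr : 0 < r)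
    (hB : Metric.closedBall c r ⊆ e.target) (ha : 0 ≤ a) (hb : b ≤ 1)
    (hγ : ContinuousOn γ (Icc a b))
    (hm : ∀ t ∈ Icc a b, γ t ∈ e.source ∧ e (γ t) ∈ Metric.closedBall c r)
    (hac : AbsolutelyContinuousOnInterval (fun t => e (γ t)) a b)
    (hd : ∀ᵐ t ∂(volume.restrict (Icc a b)),
      HasMFDerivAt 𝓘(ℝ, ℝ) (𝓡 m) γ t ((1 : ℝ →L[ℝ] ℝ).smulRight (f.1 (γ t) (u.val t)))) :
    IsIntegralSolution (ballExtension e f.1 c r) u.val (fun t => e (γ t)) a b := by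
  obtain ⟨D, hD, hbl⟩ := f.exists_boundedLipschitzOn he (isCompact_closedBall c r) hB
  obtain ⟨C, -, hu⟩ := u.exists_essBoundedOn
  have hcont : ContinuousOn (fun t => e (γ t)) (Icc a b) :=
    e.continuousOn.comp hγ fun t ht => (hm t ht).1
  have hG := continuous_of_norm_sub_le (ballExtension_bounds hr hD hbl).2
  refine ⟨hcont, hac.eq_add_integral (hu.mono (Icc_subset_Icc ha hb))
    (hG.comp_continuousOn hcont) ?_⟩
  filter_upwards [hd, ae_restrict_mem measurableSet_Icc] with t ht htI
  have := (hasMFDerivAt_iff_hasDerivAt_chart he f.1 (hm t htI).1 ht.continuousAt).1 ht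
  rw [← ballExtension_of_mem f.1 hr (hm t htI).2] at this
  exact this

theorem IsIntegralSolution.exists_lipschitzOnWith {X : Type*} [NormedAddCommGroup X]
    [NormedSpace ℝ X] {G : X → E →L[ℝ] X} {v : ℝ → E} {x : ℝ → X} {C : ℝ}
    (hx : IsIntegralSolution G v x a b) (hv : EssBoundedOn v C a b) (hG : Continuous G) :
    ∃ L, LipschitzOnWith L x (Icc a b) := by
  obtain ⟨M, hM⟩ := isCompact_Icc.exists_bound_of_continuousOn (hG.comp_continuousOn hx.1)
  refine ⟨(M * C).toNNReal, LipschitzOnWith.of_dist_le_mul fun s hs t ht => ?_⟩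
  rw [dist_eq_norm, hx.sub_eq hv hG ht hs, Real.dist_eq]
  refine (hv.norm_integral_apply_le (h := fun s => G (x s)) ht hs
    fun r hr => hM r (uIcc_subset_Icc ht hs hr)).trans ?_
  gcongr
  exact Real.le_coe_toNNReal _

/-- In a chart ball an absolutely continuous solution is the integral of a bounded function, hence
Lipschitz. The local Lipschitz condition is easier to glue, and on compact intervals it gives
absolute continuity back (`IsSolutionOn.isCauchySolution`). -/
theorem IsCauchySolution.isSolutionOn {o : M} (h : IsCauchySolution o f u γ) :
    IsSolutionOn f u γ 0 1 := by
  refine ⟨h.continuousOn, fun t ht e he hte => ?_, h.deriv_ae⟩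
  obtain ⟨r, hr, hB⟩ := Metric.nhds_basis_closedBall.mem_iff.1
    (e.open_target.mem_nhds (e.map_source hte))
  obtain ⟨ε, hε, hm⟩ := exists_interval_mapsTo_closedBall h.continuousOn ht hte hr
  have hsub : Icc (max 0 (t - ε)) (min 1 (t + ε)) ⊆ Icc 0 1 :=
    Icc_subset_Icc (le_max_left _ _) (min_le_left _ _)
  have hm' : ∀ s ∈ Icc (max 0 (t - ε)) (min 1 (t + ε)),
      γ s ∈ e.source ∧ e (γ s) ∈ Metric.closedBall (e (γ t)) r := fun s hs => by
    refine hm s (hsub hs) (abs_le.2 ⟨?_, ?_⟩)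
    · linarith [(le_max_right 0 (t - ε)).trans hs.1]
    · linarith [hs.2.trans (min_le_right 1 (t + ε))]
  have hle : max 0 (t - ε) ≤ min 1 (t + ε) :=
    (max_le ht.1 (by linarith)).trans (le_min ht.2 (by linarith))
  have hsol := isIntegralSolution_chart he hr hB (le_max_left _ _) (min_le_left _ _)
    (h.continuousOn.mono hsub) hm'
    (h.absolutelyContinuous e he _ _ (le_max_left _ _) hle (min_le_left _ _) fun s hs => (hm' s hs).1)
    (ae_mono (Measure.restrict_mono_set _ hsub) h.deriv_ae)
  obtain ⟨D, hD, hbl⟩ := f.exists_boundedLipschitzOn he (isCompact_closedBall (e (γ t)) r) hB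
  obtain ⟨C, -, hu⟩ := u.exists_essBoundedOn
  obtain ⟨L, hL⟩ := hsol.exists_lipschitzOnWith (hu.mono hsub)
    (continuous_of_norm_sub_le (ballExtension_bounds hr hD hbl).2)
  refine ⟨L, _, ?_, hL⟩
  have : Icc (max 0 (t - ε)) (min 1 (t + ε)) = Icc (0 : ℝ) 1 ∩ Icc (t - ε) (t + ε) := by
    rw [Icc_inter_Icc]
  rw [this]
  exact inter_mem_nhdsWithin _ (Icc_mem_nhds (by linarith) (by linarith))

theorem IsSolutionOn.exists_lipschitzOnWith (h : IsSolutionOn f u γ a b)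
    (he : e ∈ IsManifold.maximalAtlas (𝓡 m) ∞ M) (hm : MapsTo γ (Icc a b) e.source) :
    ∃ L, LipschitzOnWith L (fun t => e (γ t)) (Icc a b) :=
  LocallyLipschitzOn.exists_lipschitzOnWith_of_compact isCompact_Icc
    fun t ht => h.locallyLipschitz t ht e he (hm ht)

theorem IsSolutionOn.mono (h : IsSolutionOn f u γ a b) {a' b' : ℝ} (hsub : Icc a' b' ⊆ Icc a b) :
    IsSolutionOn f u γ a' b' :=
  ⟨h.continuousOn.mono hsub, fun t ht e he hte => by
    obtain ⟨L, s, hs, hL⟩ := h.locallyLipschitz t (hsub ht) e he hte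
    exact ⟨L, s, nhdsWithin_mono t hsub hs, hL⟩,
    ae_mono (Measure.restrict_mono_set _ hsub) h.deriv_ae⟩

theorem IsSolutionOn.isIntegralSolution (h : IsSolutionOn f u γ a b)
    (he : e ∈ IsManifold.maximalAtlas (𝓡 m) ∞ M) (hr : 0 < r)
    (hB : Metric.closedBall c r ⊆ e.target) (ha : 0 ≤ a) (hab : a ≤ b) (hb : b ≤ 1)
    (hm : ∀ t ∈ Icc a b, γ t ∈ e.source ∧ e (γ t) ∈ Metric.closedBall c r) :
    IsIntegralSolution (ballExtension e f.1 c r) u.val (fun t => e (γ t)) a b := by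
  obtain ⟨L, hL⟩ := h.exists_lipschitzOnWith he fun t ht => (hm t ht).1
  rw [← uIcc_of_le hab] at hL
  exact isIntegralSolution_chart he hr hB ha hb h.continuousOn hm
    hL.absolutelyContinuousOnInterval h.deriv_ae

theorem IsSolutionOn.isCauchySolution (h : IsSolutionOn f u γ 0 1) :
    IsCauchySolution (γ 0) f u γ :=
  ⟨rfl, h.continuousOn, fun e he a b ha hab hb hm => by
    obtain ⟨L, hL⟩ := (h.mono (Icc_subset_Icc ha hb)).exists_lipschitzOnWith he hm
    rw [← uIcc_of_le hab] at hL
    exact hL.absolutelyContinuousOnInterval, h.deriv_ae⟩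

theorem IsIntegralSolution.isSolutionOn {x : ℝ → EuclideanSpace ℝ (Fin m)}
    (hx : IsIntegralSolution (ballExtension e f.1 c r) u.val x a b)
    (he : e ∈ IsManifold.maximalAtlas (𝓡 m) ∞ M) (hr : 0 < r)
    (hB : Metric.closedBall c r ⊆ e.target) (ha : 0 ≤ a) (hab : a ≤ b) (hb : b ≤ 1)
    (hm : ∀ t ∈ Icc a b, x t ∈ Metric.closedBall c r) :
    IsSolutionOn f u (fun t => e.symm (x t)) a b := by
  obtain ⟨D, hD, hbl⟩ := f.exists_boundedLipschitzOn he (isCompact_closedBall c r) hB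
  obtain ⟨C, -, hu⟩ := u.exists_essBoundedOn
  replace hu := hu.mono (Icc_subset_Icc ha hb)
  have hG := continuous_of_norm_sub_le (ballExtension_bounds hr hD hbl).2
  refine ⟨e.symm.continuousOn.comp hx.1 fun t ht => hB (hm t ht), fun t ht e' he' hte => ?_, ?_⟩
  · obtain ⟨L, hL⟩ := hx.exists_lipschitzOnWith hu hG
    obtain ⟨L', s, hs, hL'⟩ := ((contDiffAt_coordChange he he' (hB (hm t ht)) hte).of_le
      (m := 1) (by norm_cast)).exists_lipschitzOnWith
    refine ⟨L' * L, Icc a b ∩ x ⁻¹' s, inter_mem self_mem_nhdsWithin (hx.1 t ht hs), ?_⟩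
    exact hL'.comp (hL.mono inter_subset_left) fun _ h => h.2
  · have hi := hu.intervalIntegrable_apply (hG.comp_continuousOn hx.1) (left_mem_Icc.2 hab)
      (right_mem_Icc.2 hab)
    have h0 : ∀ᵐ t : ℝ, t ≠ a := by simp [ae_iff, measure_singleton]
    have h1 : ∀ᵐ t : ℝ, t ≠ b := by simp [ae_iff, measure_singleton]
    rw [ae_restrict_iff' measurableSet_Icc]
    filter_upwards [hi.ae_hasDerivAt_integral, h0, h1] with t ht hta htb htI
    rw [uIcc_of_le hab] at ht
    have hn : Icc a b ∈ 𝓝 t := Icc_mem_nhds (htI.1.lt_of_ne' hta) (htI.2.lt_of_ne htb)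
    have hd : HasDerivAt x (ballExtension e f.1 c r (x t) (u.val t)) t := by
      refine ((ht htI a (left_mem_Icc.2 hab)).const_add (x a)).congr_of_eventuallyEq ?_
      filter_upwards [hn] with s hs using hx.2 s hs
    have hxt := hB (hm t htI)
    have hc : ContinuousAt (fun t => e.symm (x t)) t :=
      (e.continuousAt_symm hxt).comp hd.continuousAt
    refine (hasMFDerivAt_iff_hasDerivAt_chart (γ := fun t => e.symm (x t)) he f.1
      (e.map_target hxt) hc).2 ?_
    simp only [e.right_inv hxt]
    rw [ballExtension_of_mem f.1 hr (hm t htI)] at hd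
    refine hd.congr_of_eventuallyEq ?_
    filter_upwards [hn] with s hs using e.right_inv (hB (hm s hs))

/-- The derivatives take values in the tangent spaces at γ t and γ' t, which are equal only
propositionally; passing to a chart avoids the transport. -/
theorem hasMFDerivAt_of_eventuallyEq [IsManifold (𝓡 m) ∞ M]
    (f : (p : M) → E →L[ℝ] TangentSpace (𝓡 m) p) {t : ℝ} {v : E}
    (h : HasMFDerivAt 𝓘(ℝ, ℝ) (𝓡 m) γ t ((1 : ℝ →L[ℝ] ℝ).smulRight (f (γ t) v)))
    (heq : γ' =ᶠ[𝓝 t] γ) :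
    HasMFDerivAt 𝓘(ℝ, ℝ) (𝓡 m) γ' t ((1 : ℝ →L[ℝ] ℝ).smulRight (f (γ' t) v)) := by
  have he := IsManifold.chart_mem_maximalAtlas (I := 𝓡 m) (n := ∞) (γ t)
  have hte : γ t ∈ (chartAt (EuclideanSpace ℝ (Fin m)) (γ t)).source := mem_chart_source _ _
  have ht : γ' t = γ t := heq.self_of_nhds
  have hd := (hasMFDerivAt_iff_hasDerivAt_chart he f hte h.continuousAt).1 h
  refine (hasMFDerivAt_iff_hasDerivAt_chart he f (ht ▸ hte)
    (h.continuousAt.congr heq.symm)).2 ?_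
  rw [ht]
  exact hd.congr_of_eventuallyEq (heq.fun_comp _)

theorem IsSolutionOn.glue [IsManifold (𝓡 m) ∞ M] {b' : ℝ} (h : IsSolutionOn f u γ a b)
    (h' : IsSolutionOn f u γ' b b') (hab : a ≤ b) (hbb : b ≤ b') (hγ : γ b = γ' b) :
    IsSolutionOn f u (fun t => if t ≤ b then γ t else γ' t) a b' := by
  set η : ℝ → M := fun t => if t ≤ b then γ t else γ' t with hη
  have e1 : EqOn η γ (Icc a b) := fun t ht => if_pos ht.2
  have e2 : EqOn η γ' (Icc b b') := fun t ht => by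
    rcases ht.1.eq_or_lt with rfl | hlt
    · simp [hη, hγ]
    · exact if_neg (not_le.2 hlt)
  have hU : Icc a b ∪ Icc b b' = Icc a b' := Icc_union_Icc_eq_Icc hab hbb
  refine ⟨?_, fun t ht e he hte => ?_, ?_⟩
  · rw [← hU]
    exact (h.continuousOn.congr e1).union_of_isClosed (h'.continuousOn.congr e2)
      isClosed_Icc isClosed_Icc
  · rcases lt_trichotomy t b with htb | rfl | htb
    · have htI : t ∈ Icc a b := ⟨ht.1, htb.le⟩
      rw [e1 htI] at hte
      obtain ⟨L, s, hs, hL⟩ := h.locallyLipschitz t htI e he hte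
      refine ⟨L, Icc a b ∩ s, nhdsWithin_le_of_mem ?_ (inter_mem self_mem_nhdsWithin hs),
        fun x hx y hy => by
          beta_reduce
          rw [e1 hx.1, e1 hy.1]
          exact hL hx.2 hy.2⟩
      filter_upwards [self_mem_nhdsWithin, mem_nhdsWithin_of_mem_nhds (Iio_mem_nhds htb)]
        with x hx hxb using ⟨hx.1, le_of_lt hxb⟩
    · have htI : t ∈ Icc a t := ⟨ht.1, le_rfl⟩
      have htI' : t ∈ Icc t b' := ⟨le_rfl, ht.2⟩
      obtain ⟨L, s, hs, hL⟩ := h.locallyLipschitz t htI e he (by rwa [← e1 htI])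
      obtain ⟨L', s', hs', hL'⟩ := h'.locallyLipschitz t htI' e he (by rwa [← e2 htI'])
      have hts := mem_of_mem_nhdsWithin htI hs
      have hts' := mem_of_mem_nhdsWithin htI' hs'
      refine ⟨L ⊔ L', (Icc a t ∩ s) ∪ (Icc t b' ∩ s'), ?_, ?_⟩
      · rw [← hU, nhdsWithin_union]
        exact union_mem_sup (inter_mem self_mem_nhdsWithin hs) (inter_mem self_mem_nhdsWithin hs')
      · have l1 : ∀ x ∈ Icc a t ∩ s, ∀ y ∈ Icc a t ∩ s,
            dist (e (η x)) (e (η y)) ≤ (L ⊔ L' : NNReal) * dist x y := fun x hx y hy => by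
          rw [e1 hx.1, e1 hy.1]
          refine (hL.dist_le_mul x hx.2 y hy.2).trans ?_
          gcongr
          exact le_sup_left
        have l2 : ∀ x ∈ Icc t b' ∩ s', ∀ y ∈ Icc t b' ∩ s',
            dist (e (η x)) (e (η y)) ≤ (L ⊔ L' : NNReal) * dist x y := fun x hx y hy => by
          rw [e2 hx.1, e2 hy.1]
          refine (hL'.dist_le_mul x hx.2 y hy.2).trans ?_
          gcongr
          exact le_sup_right
        -- Across the junction the estimates add up through the junction point, because distances on
        -- the line are additive.
        have l3 : ∀ x ∈ Icc a t ∩ s, ∀ y ∈ Icc t b' ∩ s',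
            dist (e (η x)) (e (η y)) ≤ (L ⊔ L' : NNReal) * dist x y := fun x hx y hy => by
          have d1 := l1 x hx t ⟨htI, hts⟩
          have d2 := l2 t ⟨htI', hts'⟩ y hy
          have d3 : dist x y = dist x t + dist t y := by
            rw [dist_comm x y, dist_comm x t, dist_comm t y, Real.dist_eq, Real.dist_eq,
              Real.dist_eq, abs_of_nonneg (by linarith [hx.1.2, hy.1.1]),
              abs_of_nonneg (by linarith [hx.1.2]), abs_of_nonneg (by linarith [hy.1.1])]
            ring
          rw [d3, mul_add]
          exact (dist_triangle _ _ _).trans (add_le_add d1 d2)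
        refine LipschitzOnWith.of_dist_le_mul fun x hx y hy => ?_
        rcases hx with hx | hx <;> rcases hy with hy | hy
        · exact l1 x hx y hy
        · exact l3 x hx y hy
        · rw [dist_comm, dist_comm x y]
          exact l3 y hy x hx
        · exact l2 x hx y hy
    · have htI : t ∈ Icc b b' := ⟨htb.le, ht.2⟩
      rw [e2 htI] at hte
      obtain ⟨L, s, hs, hL⟩ := h'.locallyLipschitz t htI e he hte
      refine ⟨L, Icc b b' ∩ s, nhdsWithin_le_of_mem ?_ (inter_mem self_mem_nhdsWithin hs),
        fun x hx y hy => by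
          beta_reduce
          rw [e2 hx.1, e2 hy.1]
          exact hL hx.2 hy.2⟩
      filter_upwards [self_mem_nhdsWithin, mem_nhdsWithin_of_mem_nhds (Ioi_mem_nhds htb)]
        with x hx hxb using ⟨le_of_lt hxb, hx.2⟩
  · have d1 := (ae_restrict_iff' measurableSet_Icc).1 h.deriv_ae
    have d2 := (ae_restrict_iff' measurableSet_Icc).1 h'.deriv_ae
    have h0 : ∀ᵐ t : ℝ, t ≠ b := by simp [ae_iff, measure_singleton]
    rw [ae_restrict_iff' measurableSet_Icc]
    filter_upwards [d1, d2, h0] with t h1 h2 htb htI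
    rcases htb.lt_or_gt with htb | htb
    · refine hasMFDerivAt_of_eventuallyEq f.1 (h1 ⟨htI.1, htb.le⟩) ?_
      filter_upwards [Iio_mem_nhds htb] with s hs using if_pos (le_of_lt hs)
    · refine hasMFDerivAt_of_eventuallyEq f.1 (h2 ⟨htb.le, htI.2⟩) ?_
      filter_upwards [Ioi_mem_nhds htb] with s hs using if_neg (not_le.2 hs)

/-- The set of agreement is closed because M is Hausdorff, and it extends to the right of each of
its points by the quantitative estimate in a chart with all three errors zero. -/
theorem IsSolutionOn.eqOn [IsManifold (𝓡 m) ∞ M] [T2Space M] [FiniteDimensional ℝ E]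
    (h : IsSolutionOn f u γ a b) (h' : IsSolutionOn f u γ' a b) (ha : 0 ≤ a) (hb : b ≤ 1)
    (hγ : γ a = γ' a) : EqOn γ γ' (Icc a b) := by
  have : CompleteSpace E := FiniteDimensional.complete ℝ E
  have hclosed : IsClosed ({t | γ t = γ' t} ∩ Icc a b) := by
    have : {t | γ t = γ' t} ∩ Icc a b = Icc a b ∩ (fun t => (γ t, γ' t)) ⁻¹' diagonal M := by
      ext t
      simp [and_comm]
    rw [this]
    exact (h.continuousOn.prodMk h'.continuousOn).preimage_isClosed_of_isClosed isClosed_Icc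
      isClosed_diagonal
  refine fun t ht => hclosed.Icc_subset_of_forall_mem_nhdsWithin hγ (fun t ht => ?_) ht
  have htI : t ∈ Icc a b := Ico_subset_Icc_self ht.2
  have hte : γ t ∈ (chartAt (EuclideanSpace ℝ (Fin m)) (γ t)).source := mem_chart_source _ _
  have he := IsManifold.chart_mem_maximalAtlas (I := 𝓡 m) (n := ∞) (γ t)
  set e := chartAt (EuclideanSpace ℝ (Fin m)) (γ t)
  have hte' : γ' t ∈ e.source := ht.1 ▸ hte
  obtain ⟨r, hr, hB⟩ := Metric.nhds_basis_closedBall.mem_iff.1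
    (e.open_target.mem_nhds (e.map_source hte))
  obtain ⟨ε, hε, hm⟩ := exists_interval_mapsTo_closedBall h.continuousOn htI hte hr
  obtain ⟨ε', hε', hm'⟩ := exists_interval_mapsTo_closedBall h'.continuousOn htI hte' hr
  rw [← ht.1.out] at hm'
  set d := min b (t + min ε ε') with hd
  have htd : t < d := lt_min ht.2.2 (by linarith [lt_min hε hε'])
  have hsub : Icc t d ⊆ Icc a b := Icc_subset_Icc htI.1 (min_le_left _ _)
  have habs : ∀ s ∈ Icc t d, |s - t| ≤ ε ∧ |s - t| ≤ ε' := fun s hs => by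
    have h1 : s ≤ t + min ε ε' := hs.2.trans (min_le_right _ _)
    rw [abs_of_nonneg (by linarith [hs.1])]
    constructor
    · linarith [min_le_left ε ε']
    · linarith [min_le_right ε ε']
  have h0t : 0 ≤ t := ha.trans htI.1
  have hd1 : d ≤ 1 := (min_le_left _ _).trans hb
  have i1 := (h.mono hsub).isIntegralSolution he hr hB h0t htd.le hd1
    fun s hs => hm s (hsub hs) (habs s hs).1
  have i2 := (h'.mono hsub).isIntegralSolution he hr hB h0t htd.le hd1
    fun s hs => hm' s (hsub hs) (habs s hs).2
  obtain ⟨D, hD, hbl⟩ := f.exists_boundedLipschitzOn he (isCompact_closedBall (e (γ t)) r) hB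
  obtain ⟨C, hC, hu⟩ := u.exists_essBoundedOn
  have hbds := ballExtension_bounds hr hD hbl
  replace hu := hu.mono (Icc_subset_Icc h0t hd1)
  have key := i1.norm_sub_le i2 htd.le hC (by positivity) hD (continuous_of_norm_sub_le hbds.2)
    hbds.2 hbds.1 (δ := 0) (d := 0) (by simp) hu hu (by simp)
  refine mem_of_superset (Ioc_mem_nhdsGT htd) fun s hs => ?_
  have hsI : s ∈ Icc t d := Ioc_subset_Icc_self hs
  have k := key s hsI
  rw [ht.1.out] at k
  have k' : e (γ s) = e (γ' s) := by
    simpa [sub_eq_zero] using k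
  exact e.injOn (hm s (hsub hsI) (habs s hsI).1).1 (hm' s (hsub hsI) (habs s hsI).2).1 k'

end Solutions

/-! ### Stability of solutions under perturbation of all data. -/

theorem IsIntegralSolution.norm_sub_le_of_length_le_one {E X : Type*} [NormedAddCommGroup E]
    [NormedSpace ℝ E] [NormedAddCommGroup X] [NormedSpace ℝ X] [CompleteSpace E] [CompleteSpace X]
    {a b C L M : ℝ} {u u' : ℝ → E} {G G' : X → E →L[ℝ] X} {x x' : ℝ → X}
    (hx : IsIntegralSolution G u x a b)
    (hx' : IsIntegralSolution G' u' x' a b) (hab : a ≤ b) (hab1 : b - a ≤ 1) (hC : 0 ≤ C)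
    (hL : 0 ≤ L) (hM : 0 ≤ M)
    (hG : Continuous G) (hG' : ∀ y z, ‖G' y - G' z‖ ≤ L * ‖y - z‖) (hGM : ∀ y, ‖G' y‖ ≤ M)
    {δ : ℝ} (hGG : ∀ y, ‖G y - G' y‖ ≤ δ) (hu : EssBoundedOn u C a b)
    (hu' : EssBoundedOn u' C a b)
    (hd : ∀ s ∈ Icc a b, ∀ t ∈ Icc a b, ‖∫ r in s..t, (u r - u' r)‖ ≤ δ) :
    ∀ t ∈ Icc a b, ‖x t - x' t‖ ≤
      (‖x a - x' a‖ + δ * (C + (M + L * (M * C)))) * Real.exp (L * C) := by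
  intro t ht
  have hδ : 0 ≤ δ := (norm_nonneg _).trans (hGG 0)
  have h0 : 0 ≤ b - a := by linarith
  have h1 : 0 ≤ t - a := by linarith [ht.1]
  have h2 : t - a ≤ 1 := by linarith [ht.2]
  refine (hx.norm_sub_le hx' hab hC hL hM hG hG' hGM hGG hu hu' hd t ht).trans ?_
  have e1 : δ * C * (b - a) ≤ δ * C * 1 := by gcongr
  have e2 : δ * (M + L * (M * C) * (b - a)) ≤ δ * (M + L * (M * C) * 1) := by gcongr
  have e3 : Real.exp (L * C * (t - a)) ≤ Real.exp (L * C * 1) := by gcongr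
  rw [mul_one] at e3
  refine mul_le_mul (by linarith) e3 (Real.exp_nonneg _) (by positivity)

section LocalStep

variable {m : ℕ} {E M : Type*} [NormedAddCommGroup E] [NormedSpace ℝ E]
  [TopologicalSpace M] [ChartedSpace (EuclideanSpace ℝ (Fin m)) M]
  {e : OpenPartialHomeomorph M (EuclideanSpace ℝ (Fin m))}

/-- Two sections are bounded and Lipschitz with constant `C`, and uniformly `δ`-close, on `B`. -/
def SectionClose (e : OpenPartialHomeomorph M (EuclideanSpace ℝ (Fin m)))
    (B : Set (EuclideanSpace ℝ (Fin m))) (C δ : ℝ) (f g : LipSection m E M) : Prop :=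
  BoundedLipschitzOn (sectionInChart e f.1) B C ∧ BoundedLipschitzOn (sectionInChart e g.1) B C ∧
    ∀ x ∈ B, ‖sectionInChart e g.1 x - sectionInChart e f.1 x‖ ≤ δ

/-- Two controls are bounded by `C`, and their primitives are `δ`-close. -/
def ControlClose (C δ : ℝ) (u w : Control E) : Prop :=
  EssBoundedOn u.val C 0 1 ∧ EssBoundedOn w.val C 0 1 ∧
    ∀ s ∈ Icc (0 : ℝ) 1, ∀ t ∈ Icc (0 : ℝ) 1, ‖∫ r in s..t, (w.val r - u.val r)‖ ≤ δ

theorem iUnion_chainReach_sectionClose_mem_nhds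
    (he : e ∈ IsManifold.maximalAtlas (𝓡 m) ∞ M) {B : Set (EuclideanSpace ℝ (Fin m))}
    (hB : IsCompact B) (hBe : B ⊆ e.target) {C δ : ℕ → ℝ} (hC : Monotone C)
    (hCtop : Tendsto C atTop atTop) (hδ : ∀ n, 0 < δ n) (f : LipSection m E M) :
    ⋃ n, chainReach (fun n => SectionClose e B (C n) (δ n)) f n ∈ 𝓝 f := by
  refine iUnion_chainReach_mem_nhds (conv := LipSection.Converges) fun g g' hg => ?_
  obtain ⟨D, -, hD⟩ := hg.exists_boundedLipschitzOn he hB hBe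
  obtain ⟨D', -, hD'⟩ := g'.exists_boundedLipschitzOn he hB hBe
  obtain ⟨N, hN⟩ := (hCtop.eventually_ge_atTop (max D D')).exists
  refine ⟨N, fun n hn => ?_⟩
  have hn' := hN.trans (hC hn)
  filter_upwards [Metric.tendstoUniformlyOn_iff.1 (hg.tendstoUniformlyOn he hB hBe) (δ n) (hδ n)]
    with k hk
  refine ⟨hD'.weaken ((le_max_right _ _).trans hn'), (hD k).weaken ((le_max_left _ _).trans hn'),
    fun x hx => ?_⟩
  have := (hk x hx).le
  rwa [dist_comm, dist_eq_norm] at this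

/-- For the sequential part, Banach–Steinhaus bounds each convergent sequence. For controls bounded
by a given D, a single step from u at a late index already covers a weak* neighbourhood. -/
theorem iUnion_chainReach_controlClose_mem [FiniteDimensional ℝ E] {C δ : ℕ → ℝ} (hC : Monotone C)
    (hCtop : Tendsto C atTop atTop) (hδ : ∀ n, 0 < δ n) (u : Control E) :
    ⋃ n, chainReach (fun n => ControlClose (C n) (δ n)) u n ∈ u.boundedWeakStarNhds := by
  have : CompleteSpace E := FiniteDimensional.complete ℝ E
  refine mem_sup.2 ⟨?_, ?_⟩
  · refine iUnion_chainReach_mem_nhds (conv := Control.WeakStarConverges) fun w w' hw => ?_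
    obtain ⟨D, hD⟩ := hw.exists_essBoundedOn
    obtain ⟨D', -, hD'⟩ := w'.exists_essBoundedOn
    obtain ⟨N, hN⟩ := (hCtop.eventually_ge_atTop (max D D')).exists
    refine ⟨N, fun n hn => ?_⟩
    have hn' := hN.trans (hC hn)
    have hw' := hD'.weaken ((le_max_right _ _).trans hn')
    filter_upwards [hw.tendsto.eventually
      (Control.eventually_norm_integral_sub_le hw' (hδ n))] with k hk
    have hwk := (hD k).weaken ((le_max_left _ _).trans hn')
    exact ⟨hw', hwk, hk hwk⟩
  · refine mem_iSup.2 fun D => mem_inf_principal.2 ?_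
    obtain ⟨D', -, hD'⟩ := u.exists_essBoundedOn
    obtain ⟨N, hN⟩ := (hCtop.eventually_ge_atTop (max D D')).exists
    have hu := hD'.weaken ((le_max_right _ _).trans hN)
    filter_upwards [Control.eventually_norm_integral_sub_le hu (hδ N)] with w hw hwD
    have hw' := EssBoundedOn.weaken hwD ((le_max_left _ _).trans hN)
    exact mem_iUnion.2 ⟨N + 1, Or.inr ⟨u, chainReach_mono (Nat.zero_le N) rfl, hu, hw', hw hw'⟩⟩

theorem boundedLipschitzOn_of_mem_chainReach {B : Set (EuclideanSpace ℝ (Fin m))}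
    {C δ : ℕ → ℝ} (hC : Monotone C) {f : LipSection m E M}
    (hf : BoundedLipschitzOn (sectionInChart e f.1) B (C 0)) (n : ℕ) {g : LipSection m E M}
    (hg : g ∈ chainReach (fun n => SectionClose e B (C n) (δ n)) f n) :
    BoundedLipschitzOn (sectionInChart e g.1) B (C n) := by
  induction n generalizing g with
  | zero =>
    obtain rfl : g = f := hg
    exact hf
  | succ n ih =>
    rcases hg with hg | ⟨g', -, -, h, -⟩
    · exact (ih hg).weaken (hC n.le_succ)
    · exact h.weaken (hC n.le_succ)

theorem essBoundedOn_of_mem_chainReach {C δ : ℕ → ℝ} (hC : Monotone C) {u : Control E}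
    (hu : EssBoundedOn u.val (C 0) 0 1) (n : ℕ) {w : Control E}
    (hw : w ∈ chainReach (fun n => ControlClose (C n) (δ n)) u n) :
    EssBoundedOn w.val (C n) 0 1 := by
  induction n generalizing w with
  | zero =>
    obtain rfl : w = u := hw
    exact hu
  | succ n ih =>
    rcases hw with hw | ⟨w', -, -, h, -⟩
    · exact (ih hw).weaken (hC n.le_succ)
    · exact h.weaken (hC n.le_succ)

variable {f : LipSection m E M} {u : Control E} {γ : ℝ → M} {a b : ℝ}

/-- All the data close to `(γ a, f, u)` have a solution on `[a, b]` that ends close to `γ b`. -/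
def StableOn (f : LipSection m E M) (u : Control E) (γ : ℝ → M) (a b : ℝ) : Prop :=
  ∀ W ∈ 𝓝 (γ b), ∀ᶠ q : M × LipSection m E M × Control E in
    𝓝 (γ a) ×ˢ (𝓝 f ×ˢ u.boundedWeakStarNhds),
    ∃ η : ℝ → M, IsSolutionOn q.2.1 q.2.2 η a b ∧ η a = q.1 ∧ η b ∈ W

theorem IsSolutionOn.stableOn_of_chart [FiniteDimensional ℝ E] (h : IsSolutionOn f u γ a b)
    (he : e ∈ IsManifold.maximalAtlas (𝓡 m) ∞ M) {c : EuclideanSpace ℝ (Fin m)} {r : ℝ}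
    (hr : 0 < r) (hB : Metric.closedBall c r ⊆ e.target) (ha : 0 ≤ a) (hab : a ≤ b) (hb : b ≤ 1)
    (hm : ∀ t ∈ Icc a b, γ t ∈ e.source ∧ e (γ t) ∈ Metric.closedBall c (r / 2)) :
    StableOn f u γ a b := by
  intro W hW
  have : CompleteSpace E := FiniteDimensional.complete ℝ E
  have haI : a ∈ Icc a b := left_mem_Icc.2 hab
  have hbI : b ∈ Icc a b := right_mem_Icc.2 hab
  have hsub : Icc a b ⊆ Icc 0 1 := Icc_subset_Icc ha hb
  set x₀ : ℝ → EuclideanSpace ℝ (Fin m) := fun t => e (γ t) with hx₀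
  have hx : IsIntegralSolution (ballExtension e f.1 c r) u.val x₀ a b :=
    h.isIntegralSolution he hr hB ha hab hb fun t ht =>
      ⟨(hm t ht).1, Metric.closedBall_subset_closedBall (by linarith) (hm t ht).2⟩
  -- Since γ stays in the ball of radius r/2, the condition η ≤ r/2 keeps perturbed solutions in the
  -- ball of radius r, where the extended field is the true one.
  obtain ⟨η, hη, hηr, hηW⟩ : ∃ η > 0, η ≤ r / 2 ∧ ∀ y, ‖y - x₀ b‖ ≤ η → e.symm y ∈ W := by
    have h1 : ∀ᶠ y in 𝓝 (x₀ b), e.symm y ∈ W := by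
      refine (e.continuousAt_symm (e.map_source (hm b hbI).1)).eventually ?_
      rwa [e.left_inv (hm b hbI).1]
    obtain ⟨η, hη, h2⟩ := Metric.nhds_basis_closedBall.mem_iff.1 h1
    refine ⟨min η (r / 2), lt_min hη (by positivity), min_le_right _ _, fun y hy => h2 ?_⟩
    rw [mem_closedBall_iff_norm]
    exact hy.trans (min_le_left _ _)
  obtain ⟨D, hD, hfD⟩ := f.exists_boundedLipschitzOn he (isCompact_closedBall c r) hB
  obtain ⟨D', hD', huD'⟩ := u.exists_essBoundedOn
  set C : ℕ → ℝ := fun n => max D D' + n with hC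
  have hC0 : ∀ n, 0 ≤ C n := fun n => by positivity
  have hCmono : Monotone C := fun i j hij => by
    simp only [hC]
    gcongr
  have hCtop : Tendsto C atTop atTop :=
    tendsto_atTop_add_const_left _ _ tendsto_natCast_atTop_atTop
  -- The constant of the stability estimate for M = C n and L = 2 C n; the 2 comes from the radial
  -- retraction.
  set P : ℕ → ℝ := fun n => (C n + (C n + 2 * C n * (C n * C n))) * Real.exp (2 * C n * C n) with hP
  have hP0 : ∀ n, 0 ≤ P n := fun n => by
    have := hC0 n
    positivity
  set δ : ℕ → ℝ := fun n => η * (1 / 2) ^ (n + 2) / (P n + 1) with hδdef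
  have hδ : ∀ n, 0 < δ n := fun n => by
    have := hP0 n
    positivity
  have hδP : ∀ n, δ n * P n ≤ η * (1 / 2) ^ (n + 2) := fun n => by
    have := hP0 n
    rw [hδdef]
    simp only
    rw [div_mul_eq_mul_div, div_le_iff₀ (by linarith)]
    have h3 : 0 ≤ η * (1 / 2 : ℝ) ^ (n + 2) := by positivity
    linarith
  have hf0 : BoundedLipschitzOn (sectionInChart e f.1) (Metric.closedBall c r) (C 0) :=
    hfD.weaken (by simp [hC])
  have hu0 : EssBoundedOn u.val (C 0) 0 1 := huD'.weaken (by simp [hC])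
  set F := chainReach (fun n => SectionClose e (Metric.closedBall c r) (C n) (δ n)) f with hF
  set V := chainReach (fun n => ControlClose (C n) (δ n)) u with hV
  have hFn : ∀ n, ∀ g ∈ F n, BoundedLipschitzOn (sectionInChart e g.1) (Metric.closedBall c r) (C n) :=
    fun n g hg => boundedLipschitzOn_of_mem_chainReach hCmono hf0 n hg
  have hVn : ∀ n, ∀ w ∈ V n, EssBoundedOn w.val (C n) 0 1 :=
    fun n w hw => essBoundedOn_of_mem_chainReach hCmono hu0 n hw
  have hO : ∀ᶠ p in 𝓝 (γ a), p ∈ e.source ∧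
      ‖e p - x₀ a‖ * Real.exp (2 * C 0 * C 0) ≤ η * (1 / 2) := by
    refine (e.open_source.eventually_mem (hm a haI).1).and ?_
    have hcont : ContinuousAt (fun p => ‖e p - x₀ a‖ * Real.exp (2 * C 0 * C 0)) (γ a) :=
      (((e.continuousAt (hm a haI).1).sub continuousAt_const).norm).mul continuousAt_const
    refine (hcont.eventually_lt continuousAt_const ?_).mono fun _ h => h.le
    simp only [hx₀, sub_self, norm_zero, zero_mul]
    positivity
  -- Stage 0 changes only the initial point, at cost η/2. Stage n + 1 keeps it and changes section
  -- and control, at cost δ n * P n ≤ η 2^{-(n+2)}; the partial sums are η(1 - 2^{-(n+1)}).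
  have key : ∀ n, ∀ p, ‖e p - x₀ a‖ * Real.exp (2 * C 0 * C 0) ≤ η * (1 / 2) → ∀ g ∈ F n,
      ∀ w ∈ V n, ∃ x, IsIntegralSolution (ballExtension e g.1 c r) w.val x a b ∧ x a = e p ∧
        ∀ t ∈ Icc a b, ‖x t - x₀ t‖ ≤ η * (1 - (1 / 2) ^ (n + 1)) := by
    intro n p hp
    induction n with
    | zero =>
      intro g hg w hw
      obtain rfl : g = f := hg
      obtain rfl : w = u := hw
      have hbd := ballExtension_bounds hr (hC0 0) hf0
      have hu1 := hu0.mono hsub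
      obtain ⟨x, hxs, hxa⟩ := exists_isIntegralSolution hab (mul_nonneg zero_le_two (hC0 0)) (hC0 0)
        hbd.2 hu1 (e p)
      refine ⟨x, hxs, hxa, fun t ht => ?_⟩
      refine (hxs.norm_sub_le_of_length_le_one hx hab (by linarith) (hC0 0)
        (mul_nonneg zero_le_two (hC0 0)) (hC0 0) (continuous_of_norm_sub_le hbd.2) hbd.2 hbd.1
        (δ := 0) (by simp) hu1 hu1 (by simp) t ht).trans ?_
      rw [hxa, zero_mul, add_zero]
      refine hp.trans (le_of_eq ?_)
      norm_num
    | succ n ih =>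
      intro g hg w hw
      obtain ⟨g', hg', -, hgn, hgg⟩ := exists_mem_chainReach_of_succ
        (fun y hy => ⟨hFn n y hy, hFn n y hy, fun z _ => by simpa using (hδ n).le⟩) hg
      obtain ⟨w', hw', -, hwn, hww⟩ := exists_mem_chainReach_of_succ
        (fun y hy => ⟨hVn n y hy, hVn n y hy, fun s _ t _ => by simpa using (hδ n).le⟩) hw
      obtain ⟨x', hxs', hxa', hxb'⟩ := ih g' hg' w' hw'
      have hbd := ballExtension_bounds hr (hC0 n) hgn
      have hbd' := ballExtension_bounds hr (hC0 n) (hFn n g' hg')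
      obtain ⟨x, hxs, hxa⟩ := exists_isIntegralSolution hab (mul_nonneg zero_le_two (hC0 n)) (hC0 n)
        hbd.2 (hwn.mono hsub) (e p)
      refine ⟨x, hxs, hxa, fun t ht => ?_⟩
      have h1 := hxs.norm_sub_le_of_length_le_one hxs' hab (by linarith) (hC0 n)
        (mul_nonneg zero_le_two (hC0 n)) (hC0 n) (continuous_of_norm_sub_le hbd.2) hbd'.2 hbd'.1
        (δ := δ n) (fun y => hgg _ (radialRetraction_mem hr y)) (hwn.mono hsub)
        ((hVn n w' hw').mono hsub) (fun s hs t ht => hww s (hsub hs) t (hsub ht)) t ht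
      rw [hxa, hxa', sub_self, norm_zero, zero_add, mul_assoc] at h1
      have h2 := h1.trans (hδP n)
      have h3 := norm_sub_le_norm_sub_add_norm_sub (x t) (x' t) (x₀ t)
      have h4 := hxb' t ht
      have h5 : η * (1 - (1 / 2 : ℝ) ^ (n + 1 + 1))
          = η * (1 / 2) ^ (n + 2) + η * (1 - (1 / 2) ^ (n + 1)) := by ring
      linarith
  have hFmem := iUnion_chainReach_sectionClose_mem_nhds he (isCompact_closedBall c r) hB hCmono
    hCtop hδ f
  have hVmem := iUnion_chainReach_controlClose_mem hCmono hCtop hδ u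
  filter_upwards [prod_mem_prod hO (prod_mem_prod hFmem hVmem)]
  rintro ⟨p, g, w⟩ ⟨⟨hps, hp⟩, hg, hw⟩
  obtain ⟨i, hi⟩ := mem_iUnion.1 hg
  obtain ⟨j, hj⟩ := mem_iUnion.1 hw
  -- The section and the control may be reached after different numbers of steps; monotonicity puts
  -- both at stage max i j.
  obtain ⟨x, hxs, hxa, hxb⟩ := key (max i j) p hp g (chainReach_mono (le_max_left _ _) hi) w
    (chainReach_mono (le_max_right _ _) hj)
  have hxη : ∀ t ∈ Icc a b, ‖x t - x₀ t‖ ≤ η := fun t ht => (hxb t ht).trans (by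
    have : (0 : ℝ) ≤ (1 / 2) ^ (max i j + 1) := by positivity
    nlinarith)
  refine ⟨fun t => e.symm (x t), hxs.isSolutionOn he hr hB ha hab hb fun t ht => ?_, ?_,
    hηW _ (hxη b hbI)⟩
  · have h1 := mem_closedBall_iff_norm.1 (hm t ht).2
    rw [mem_closedBall_iff_norm]
    have h2 := norm_sub_le_norm_sub_add_norm_sub (x t) (x₀ t) c
    linarith [hxη t ht]
  · simp only [hxa]
    exact e.left_inv hps

theorem StableOn.trans [IsManifold (𝓡 m) ∞ M] {b' : ℝ} (h : StableOn f u γ a b)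
    (h' : StableOn f u γ b b') (hab : a ≤ b) (hbb : b ≤ b') : StableOn f u γ a b' := by
  intro W hW
  obtain ⟨O, hO, N, hN, hON⟩ := mem_prod_iff.1 (h' W hW)
  filter_upwards [h O hO, tendsto_snd hN] with q ⟨η, hη, hηa, hηb⟩ hqN
  obtain ⟨η', hη', hηa', hηb'⟩ := hON (mk_mem_prod hηb hqN)
  refine ⟨_, hη.glue hη' hab hbb hηa'.symm, by simp [hab, hηa], ?_⟩
  -- If b = b', the glued curve takes its final value from the first piece.
  rcases hbb.eq_or_lt with rfl | hlt
  · rw [hηa'] at hηb'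
    simpa using hηb'
  · simpa [not_le.2 hlt] using hηb'

/-- Each time has a neighbourhood on whose subintervals γ stays in half a chart ball. A finite
subdivision subordinate to this cover reduces to the local case, and the pieces compose. -/
theorem IsSolutionOn.stableOn [IsManifold (𝓡 m) ∞ M] [FiniteDimensional ℝ E]
    (h : IsSolutionOn f u γ 0 1) : StableOn f u γ 0 1 := by
  have hloc : ∀ t : unitInterval, ∃ ε > 0, ∀ a b : unitInterval, a ≤ b →
      Icc a b ⊆ {s | |(s : ℝ) - t| < ε} → StableOn f u γ a b := by
    intro t
    have hte : γ t ∈ (chartAt (EuclideanSpace ℝ (Fin m)) (γ t)).source := mem_chart_source _ _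
    have he := IsManifold.chart_mem_maximalAtlas (I := 𝓡 m) (n := ∞) (γ t)
    set e := chartAt (EuclideanSpace ℝ (Fin m)) (γ t)
    obtain ⟨r, hr, hB⟩ := Metric.nhds_basis_closedBall.mem_iff.1
      (e.open_target.mem_nhds (e.map_source hte))
    obtain ⟨ε, hε, hm⟩ := exists_interval_mapsTo_closedBall h.continuousOn t.2 hte (half_pos hr)
    refine ⟨ε, hε, fun a b hab hsub => ?_⟩
    refine (h.mono (Icc_subset_Icc a.2.1 b.2.2)).stableOn_of_chart he hr hB a.2.1 hab b.2.2
      fun s hs => ?_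
    have hsI : s ∈ Icc (0 : ℝ) 1 := ⟨a.2.1.trans hs.1, hs.2.trans b.2.2⟩
    have hs' : (⟨s, hsI⟩ : unitInterval) ∈ Icc a b := hs
    exact hm s hsI (le_of_lt (hsub hs'))
  choose ε hε hst using hloc
  obtain ⟨t, ht0, htm, ⟨N, hN⟩, hti⟩ := exists_monotone_Icc_subset_open_cover_unitInterval
    (c := fun t : unitInterval => {s : unitInterval | |(s : ℝ) - t| < ε t})
    (fun t => isOpen_lt (by fun_prop) continuous_const)
    (fun t _ => mem_iUnion.2 ⟨t, by simpa using hε t⟩)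
  have hstep : ∀ n, StableOn f u γ (t n) (t (n + 1)) := fun n => by
    obtain ⟨i, hi⟩ := hti n
    exact hst i _ _ (htm n.le_succ) hi
  have hall : ∀ n, StableOn f u γ (t 0) (t (n + 1)) := fun n => by
    induction n with
    | zero => exact hstep 0
    | succ n ih => exact ih.trans (hstep (n + 1)) (htm (Nat.zero_le _)) (htm (Nat.le_succ _))
  have := hall N
  rw [ht0, hN (N + 1) (Nat.le_succ N)] at this
  simpa using this

theorem IsCauchySolution.eventually_exists [IsManifold (𝓡 m) ∞ M] [FiniteDimensional ℝ E] {o : M}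
    (h : IsCauchySolution o f u γ) {W : Set M} (hW : W ∈ 𝓝 (γ 1)) :
    ∀ᶠ q : M × LipSection m E M × Control E in 𝓝 o ×ˢ (𝓝 f ×ˢ u.boundedWeakStarNhds),
      ∃ η : ℝ → M, IsCauchySolution q.1 q.2.1 q.2.2 η ∧ η 1 ∈ W := by
  have := h.isSolutionOn.stableOn W hW
  rw [h.start] at this
  filter_upwards [this] with q ⟨η, hη, h0, h1⟩
  exact ⟨η, h0 ▸ hη.isCauchySolution, h1⟩

theorem IsCauchySolution.eqOn [IsManifold (𝓡 m) ∞ M] [T2Space M] [FiniteDimensional ℝ E] {o : M}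
    {γ' : ℝ → M} (h : IsCauchySolution o f u γ) (h' : IsCauchySolution o f u γ') :
    EqOn γ γ' (Icc 0 1) :=
  h.isSolutionOn.eqOn h'.isSolutionOn le_rfl le_rfl (h.start.trans h'.start.symm)

theorem IsCauchySolution.endPoint_eq [IsManifold (𝓡 m) ∞ M] [T2Space M] [FiniteDimensional ℝ E]
    {x : endPointDomain m E M} (h : IsCauchySolution x.1.1 x.1.2.1 x.1.2.2 γ) :
    endPoint x = γ 1 :=
  (Classical.choose_spec x.2).eqOn h (right_mem_Icc.2 zero_le_one)

end LocalStep

/-! ### The End-point map. -/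

theorem eventually_endPoint_mem {m : ℕ} {M : Type*} [TopologicalSpace M] [T2Space M]
    [ChartedSpace (EuclideanSpace ℝ (Fin m)) M] [IsManifold (𝓡 m) ∞ M]
    {E : Type*} [NormedAddCommGroup E] [NormedSpace ℝ E] [FiniteDimensional ℝ E]
    (x : endPointDomain m E M) {W : Set M} (hW : W ∈ 𝓝 (endPoint x)) :
    ∀ᶠ q : M × LipSection m E M × Control E in
      𝓝 x.1.1 ×ˢ (𝓝 x.1.2.1 ×ˢ x.1.2.2.boundedWeakStarNhds),
      ∃ hq : q ∈ endPointDomain m E M, endPoint ⟨q, hq⟩ ∈ W := by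
  obtain ⟨γ, hγ⟩ := x.2
  rw [hγ.endPoint_eq] at hW
  filter_upwards [hγ.eventually_exists hW] with q ⟨η, hη, hηW⟩
  have hq : q ∈ endPointDomain m E M := ⟨η, hη⟩
  refine ⟨hq, ?_⟩
  rwa [IsCauchySolution.endPoint_eq (x := ⟨q, hq⟩) hη]

theorem nhds_le_nhds_prod_boundedWeakStarNhds {m : ℕ} {M : Type*} [TopologicalSpace M]
    [ChartedSpace (EuclideanSpace ℝ (Fin m)) M]
    {E : Type*} [NormedAddCommGroup E] [NormedSpace ℝ E]
    (x : M × LipSection m E M × Control E) :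
    𝓝 x ≤ 𝓝 x.1 ×ˢ (𝓝 x.2.1 ×ˢ x.2.2.boundedWeakStarNhds) := by
  rw [show 𝓝 x = 𝓝 x.1 ×ˢ (𝓝 x.2.1 ×ˢ 𝓝 x.2.2) by rw [← nhds_prod_eq, ← nhds_prod_eq]]
  exact prod_mono le_rfl (prod_mono le_rfl le_sup_left)

theorem Control.nhdsWithin_le_boundedWeakStarNhds {E : Type*} [NormedAddCommGroup E]
    [NormedSpace ℝ E] {K : Set (Control E)} {C : ℝ} (hC : ∀ u ∈ K, EssBoundedOn u.val C 0 1)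
    (u : Control E) :
    @nhdsWithin _ (weakStarTopology E) u K ≤ u.boundedWeakStarNhds :=
  (inf_le_inf_left _ (principal_mono.2 hC)).trans
    ((le_iSup (fun C : ℝ => @nhds _ (weakStarTopology E) u ⊓
      𝓟 {w : Control E | EssBoundedOn w.val C 0 1}) C).trans le_sup_right)

/-- The Cauchy problem has at most one solution (so that the End-point map is well defined), the
domain of the End-point map is open for the product topology, the End-point map is continuous on
it, and the limit of `End(o, f, ·)` as `(o, f) → (o', f')` is uniform on every weak*-compact set
`K` of controls on which `End(o', f', ·)` is defined: for every neighbourhood `V` of the diagonal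
of `M × M`, if `(o, f)` is close enough to `(o', f')`, then for all `u ∈ K` the point
`End(o, f, u)` is defined and is `V`-close to `End(o', f', u)`. -/
theorem theorem2p2 (m : ℕ) (M : Type*) [TopologicalSpace M] [T2Space M]
    [SecondCountableTopology M] [ChartedSpace (EuclideanSpace ℝ (Fin m)) M]
    [IsManifold (𝓡 m) ∞ M]
    (E : Type*) [NormedAddCommGroup E] [NormedSpace ℝ E] [FiniteDimensional ℝ E] :
    (∀ (o : M) (f : LipSection m E M) (u : Control E) (γ γ' : ℝ → M),
      IsCauchySolution o f u γ → IsCauchySolution o f u γ' → EqOn γ γ' (Icc 0 1)) ∧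
    IsOpen (endPointDomain m E M) ∧
    Continuous (endPoint : endPointDomain m E M → M) ∧
    ∀ (o' : M) (f' : LipSection m E M) (K : Set (Control E)),
      @IsCompact (Control E) (weakStarTopology E) K →
      ∀ hK : ∀ u ∈ K, (o', f', u) ∈ endPointDomain m E M,
      ∀ V ∈ 𝓝ˢ (diagonal M),
        ∀ᶠ q : M × LipSection m E M in 𝓝 (o', f'), ∀ (u : Control E) (hu : u ∈ K),
          ∃ hq : (q.1, q.2, u) ∈ endPointDomain m E M,
            (endPoint ⟨(o', f', u), hK u hu⟩, endPoint ⟨(q.1, q.2, u), hq⟩) ∈ V := by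
  refine ⟨fun o f u γ γ' h h' => h.eqOn h', ?_, ?_, ?_⟩
  · refine isOpen_iff_mem_nhds.2 fun x hx => ?_
    filter_upwards [nhds_le_nhds_prod_boundedWeakStarNhds x
      (eventually_endPoint_mem ⟨x, hx⟩ univ_mem)] with q ⟨hq, _⟩ using hq
  · refine continuous_iff_continuousAt.2 fun x W hW => ?_
    have h := continuous_subtype_val.continuousAt.eventually
      (nhds_le_nhds_prod_boundedWeakStarNhds x.1 (eventually_endPoint_mem x hW))
    exact h.mono fun q ⟨_, hqW⟩ => hqW
  · intro o' f' K hKc hK V hV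
    have : CompleteSpace E := FiniteDimensional.complete ℝ E
    obtain ⟨C, hC⟩ := Control.exists_essBoundedOn_of_isCompact hKc
    -- The second membership is the one that is localized to subsets of K in the compactness
    -- induction; the first only supplies the proof that the limiting end-point exists.
    suffices h : ∀ᶠ q : M × LipSection m E M in 𝓝 (o', f'), ∀ (u : Control E) (hu : u ∈ K),
        u ∈ K → ∃ hq : (q.1, q.2, u) ∈ endPointDomain m E M,
          (endPoint ⟨(o', f', u), hK u hu⟩, endPoint ⟨(q.1, q.2, u), hq⟩) ∈ V from
      h.mono fun q hq u hu => hq u hu hu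
    refine @IsCompact.induction_on _ (weakStarTopology E) K hKc
      (fun s => ∀ᶠ q : M × LipSection m E M in 𝓝 (o', f'), ∀ (u : Control E) (hu : u ∈ K),
        u ∈ s → ∃ hq : (q.1, q.2, u) ∈ endPointDomain m E M,
          (endPoint ⟨(o', f', u), hK u hu⟩, endPoint ⟨(q.1, q.2, u), hq⟩) ∈ V)
      (by simp) (fun s t hst ht => ht.mono fun q hq u hu hus => hq u hu (hst hus))
      (fun s t hs ht => ?_) fun u hu => ?_
    · filter_upwards [hs, ht] with q hqs hqt u hu hust
      exact hust.elim (hqs u hu) (hqt u hu)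
    · have hVu := mem_nhdsSet_iff_forall.1 hV
        (endPoint ⟨(o', f', u), hK u hu⟩, endPoint ⟨(o', f', u), hK u hu⟩) rfl
      rw [nhds_prod_eq] at hVu
      obtain ⟨W, hW, hWV⟩ := mem_prod_same_iff.1 hVu
      obtain ⟨O, hO, N, hN, hON⟩ := mem_prod_iff.1
        (eventually_endPoint_mem ⟨(o', f', u), hK u hu⟩ hW)
      obtain ⟨F, hF, U, hU, hFU⟩ := mem_prod_iff.1 hN
      refine ⟨U, Control.nhdsWithin_le_boundedWeakStarNhds hC u hU, ?_⟩
      filter_upwards [prod_mem_nhds hO hF] with q hq w hw hwU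
      -- The unperturbed pair (o', f') also lies in the chosen neighbourhoods, so for every w in U
      -- both end-points lie in W, and W × W ⊆ V.
      obtain ⟨h₁, h₁W⟩ := hON (mk_mem_prod (mem_of_mem_nhds hO)
        (hFU (mk_mem_prod (mem_of_mem_nhds hF) hwU)))
      obtain ⟨h₂, h₂W⟩ := hON (mk_mem_prod hq.1 (hFU (mk_mem_prod hq.2 hwU)))
      exact ⟨h₂, hWV (mk_mem_prod h₁W h₂W)⟩
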